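/- Let $n\ge 1$, let $q$ be a positive, continuously differentiable probability density on $\mathbb R^n$ (with respect to Lebesgue measure), $Q$ the distribution with density $q$, and $\langle\phi,\psi\rangle=\int\phi\psi\,q$ the inner product of $L^2(Q)$. Let $\Sigma=[\sigma_{ij}]$ be a continuously differentiable function on $\mathbb R^n$ with values in the symmetric positive definite $n\times n$ matrices. Let $\mathcal D(f)$ be the set of all $\phi\in L^2(Q)$ that have a weak derivative $\nabla\phi$ (that is, $\int\phi\,\nabla u=-\int(\nabla\phi)\,u$ for all $u\in C^1_K(\mathbb R^n)$) with $\int(\nabla\phi)'\Sigma(\nabla\phi)\,q<\infty$, and for $\phi,\psi\in\mathcal D(f)$ put $$f(\phi,\psi)=\tfrac12\int(\nabla\phi)'\,\Sigma\,(\nabla\psi)\,q .$$ Assume that $C_K^2(\mathbb R^n)$ (the twice continuously differentiable functions with compact support) is a core of $f$: for every $\phi_0\in\mathcal D(f)$ there are $\phi_k\in C_K^2(\mathbb R^n)$ with $\langle\phi_k-\phi_0,\phi_k-\phi_0\rangle+f(\phi_k-\phi_0,\phi_k-\phi_0)\to0$. Assume further that $h=-\tfrac12\log q$ is twice continuously differentiable,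 that there is a constant $\underline c>0$ with $\Sigma(x)\ge\underline c\,I$ for all $x\in\mathbb R^n$, and that the potential $$V=-\sum_{i,j}\sigma_{ij}\frac{\partial^2h}{\partial y_i\partial y_j}-\sum_{i,j}\frac{\partial\sigma_{ij}}{\partial y_i}\frac{\partial h}{\partial y_j}+(\nabla h)'\Sigma(\nabla h)$$ satisfies $V(x)\to+\infty$ as $|x|\to\infty$. Then: (a) for every $\theta>0$ the set $\{\phi\in\mathcal D(f): f(\phi,\phi)+\theta\langle\phi,\phi\rangle\le1\}$ is precompact (has compact closure) in $L^2(Q)$; (b) the nonlinear principal components exist: there is a sequence $\psi_0,\psi_1,\psi_2,\dots$ in $L^2(Q)$ such that $\psi_0$ is the constant function $1$ and, for every $j\ge1$, $\psi_j$ maximizes $\langle\phi,\phi\rangle$ over all $\phi\in\mathcal D(f)$ with $f(\phi,\phi)=1$ and $\langle\psi_s,\phi\rangle=0$ for $s=0,\dots,j-1$. -/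

import Mathlib

open MeasureTheory Filter Topology
open scoped Matrix

namespace NPC

noncomputable section

/-- The state space `ℝⁿ` with its Euclidean norm. -/
abbrev State (n : ℕ) : Type := EuclideanSpace ℝ (Fin n)

variable {n : ℕ}

/-- The classical partial derivative `∂u/∂yᵢ`. -/
def partialDeriv (i : Fin n) (u : State n → ℝ) (x : State n) : ℝ :=
  fderiv ℝ u x (EuclideanSpace.single i 1)

/-- The population distribution `Q`, with Lebesgue density `q`. -/
def population (q : State n → ℝ) : Measure (State n) :=
  volume.withDensity fun x => ENNReal.ofReal (q x)

/-- The space `L²(Q)`; its inner product is `⟨φ, ψ⟩ = ∫ φ ψ q`. -/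
abbrev L2 (q : State n → ℝ) : Type := Lp ℝ 2 (population q)

/-- `g` is a weak derivative of `φ` (with respect to Lebesgue measure): both are locally
integrable, and `∫ φ ∂u/∂yᵢ = - ∫ gᵢ u` for every `u` in `C_K^1` and every `i`. -/
def IsWeakGradient (φ : State n → ℝ) (g : State n → State n) : Prop :=
  LocallyIntegrable φ ∧ LocallyIntegrable g ∧
    ∀ u : State n → ℝ, ContDiff ℝ 1 u → HasCompactSupport u →
      ∀ i : Fin n, ∫ x, φ x * partialDeriv i u x = - ∫ x, g x i * u x

/-- The integrand `a' Σ b q`, for vector fields `a` and `b`. -/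
def energyDensity (q : State n → ℝ) (S : State n → Matrix (Fin n) (Fin n) ℝ)
    (a b : State n → State n) (x : State n) : ℝ :=
  ((a x).ofLp ⬝ᵥ (S x *ᵥ (b x).ofLp)) * q x

/-- `g` is a measurable weak derivative of `φ ∈ L²(Q)` with `∫ g' Σ g q < ∞`. -/
def IsFormGradient (q : State n → ℝ) (S : State n → Matrix (Fin n) (Fin n) ℝ)
    (φ : L2 q) (g : State n → State n) : Prop :=
  Measurable g ∧ IsWeakGradient φ g ∧ Integrable (energyDensity q S g g)

/-- The domain `𝒟(f) = H̄ ⊆ L²(Q)` of the form `f`. -/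
def formDomain (q : State n → ℝ) (S : State n → Matrix (Fin n) (Fin n) ℝ) : Set (L2 q) :=
  {φ | ∃ g, IsFormGradient q S φ g}

open Classical in
/-- The weak derivative `∇φ` of `φ ∈ H̄`, which is unique up to Lebesgue-null sets
(with the value `0` outside `H̄`). -/
def weakGrad (q : State n → ℝ) (S : State n → Matrix (Fin n) (Fin n) ℝ) (φ : L2 q) :
    State n → State n :=
  if h : ∃ g, IsFormGradient q S φ g then h.choose else 0

/-- The form `f(φ, ψ) = ½ ∫ (∇φ)' Σ (∇ψ) q`, for `φ`, `ψ` in `H̄`. -/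
def form (q : State n → ℝ) (S : State n → Matrix (Fin n) (Fin n) ℝ) (φ ψ : L2 q) : ℝ :=
  (1 / 2) * ∫ x, energyDensity q S (weakGrad q S φ) (weakGrad q S ψ) x

/-- The elements of `L²(Q)` that are represented by a function in `C_K^2`. -/
def CK2 (q : State n → ℝ) : Set (L2 q) :=
  {φ | ∃ u : State n → ℝ, ContDiff ℝ 2 u ∧ HasCompactSupport u ∧ φ =ᵐ[population q] u}

/-- `C` is a core of the form `f`: a subset of `H̄`, sequentially dense in `H̄` with respect to
`⟨φ, φ⟩ + f(φ, φ)`. -/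
def IsCore (q : State n → ℝ) (S : State n → Matrix (Fin n) (Fin n) ℝ) (C : Set (L2 q)) : Prop :=
  C ⊆ formDomain q S ∧
    ∀ φ₀ ∈ formDomain q S, ∃ φ : ℕ → L2 q, (∀ k, φ k ∈ C) ∧
      Tendsto (fun k => inner ℝ (φ k - φ₀) (φ k - φ₀) + form q S (φ k - φ₀) (φ k - φ₀))
        atTop (𝓝 0)

/-- `h = -½ log q`, that is `q^{1/2} = exp (-h)`. -/
def logDensity (q : State n → ℝ) (x : State n) : ℝ := -(1 / 2) * Real.log (q x)

/-- The potential
`V = - ∑ σᵢⱼ ∂²h/∂yᵢ∂yⱼ - ∑ (∂σᵢⱼ/∂yᵢ) (∂h/∂yⱼ) + (∇h)' Σ (∇h)`. -/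
def potential (q : State n → ℝ) (S : State n → Matrix (Fin n) (Fin n) ℝ) (x : State n) : ℝ :=
  - (∑ i, ∑ j, S x i j * partialDeriv i (partialDeriv j (logDensity q)) x)
    - (∑ i, ∑ j, partialDeriv i (fun y => S y i j) x * partialDeriv j (logDensity q) x)
    + ∑ i, ∑ j, partialDeriv i (logDensity q) x * S x i j * partialDeriv j (logDensity q) x

/-- The set `{φ ∈ 𝒟(f) : f(φ, φ) + θ ⟨φ, φ⟩ ≤ 1}`. -/
def sublevel (q : State n → ℝ) (S : State n → Matrix (Fin n) (Fin n) ℝ) (θ : ℝ) : Set (L2 q) :=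
  {φ | φ ∈ formDomain q S ∧ form q S φ φ + θ * inner ℝ φ φ ≤ 1}

/-- The constraint set of the `j`-th extraction step: `φ ∈ H̄` with `f(φ, φ) = 1` and
`⟨ψₛ, φ⟩ = 0` for `s = 0, …, j - 1`. -/
def constraintSet (q : State n → ℝ) (S : State n → Matrix (Fin n) (Fin n) ℝ)
    (ψ : ℕ → L2 q) (j : ℕ) : Set (L2 q) :=
  {φ | φ ∈ formDomain q S ∧ form q S φ φ = 1 ∧ ∀ s < j, inner ℝ (ψ s) φ = 0}

/-- `ψ` is a sequence of nonlinear principal components: `ψ₀` is the constant function one, and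
for `j ≥ 1` the function `ψⱼ` maximizes `⟨φ, φ⟩` over the `j`-th constraint set. -/
def IsNPCSequence (q : State n → ℝ) (S : State n → Matrix (Fin n) (Fin n) ℝ)
    (ψ : ℕ → L2 q) : Prop :=
  (ψ 0 =ᵐ[population q] fun _ => (1 : ℝ)) ∧
    ∀ j, 1 ≤ j → ψ j ∈ constraintSet q S ψ j ∧
      ∀ φ ∈ constraintSet q S ψ j, inner ℝ φ φ ≤ inner ℝ (ψ j) (ψ j)

end

end NPC

/-! Precompactness is a matter of tails and of local oscillation. For a test function `w`, integrate
the nonnegative expression `(∇w - w∇h)'Σ(∇w - w∇h) q`. Integrating the cross term by parts, with `∇q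
= -2q∇h`, turns this into `∫ V w² q ≤ ∫ (∇w)'Σ(∇w) q` (`integral_potential_le`). As `V` diverges,
the mass of `w²` outside a large ball is at most a small multiple of energy plus norm
(`tail_estimate`). Inside the ball, `q` is bounded above and below and `Σ` is elliptic; a Poincaré
inequality on small convex cells then controls `∫ w² q` by finitely many cell averages plus a small
multiple of the energy (`local_estimate`). Together, for every `ε`, the norm is controlled by
finitely many continuous functionals up to `ε` times energy plus norm. The core property carries
this to the whole domain (`domain_estimate`), and it makes the sublevel sets totally bounded.

The components come from the direct method. The form is closed (`form_closed`), so on each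
constraint space a maximizing sequence has a norm-convergent subsequence. If `s` is the supremum,
`f(φ, φ) - s⁻¹⟨φ, φ⟩` is a nonnegative quadratic form tending to zero along it; the parallelogram
law then gives convergence in energy as well, so the limit is a maximizer
(`CompactForm.exists_maximizer`). Two points remain. The supremum is finite because an element of
zero energy orthogonal to `1` vanishes: Poincaré on growing balls forces equality in Cauchy-Schwarz
against `1`. The constraint space is nonzero because the test functions span an infinite-dimensional
space. -/

namespace NPC

universe u

variable {n : ℕ} {q : State n → ℝ} {S : State n → Matrix (Fin n) (Fin n) ℝ} {c : ℝ}

/-- Standing assumptions on the density and on the diffusion matrix: positivity, continuity and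
uniform ellipticity. -/
structure Admissible (q : State n → ℝ) (S : State n → Matrix (Fin n) (Fin n) ℝ) (c : ℝ) : Prop where
  pos : ∀ x, 0 < q x
  cont : Continuous q
  prob : IsProbabilityMeasure (population q)
  coeff_cont : ∀ i j, Continuous fun x => S x i j
  ell_pos : 0 < c
  ell : ∀ x (a : Fin n → ℝ), c * (a ⬝ᵥ a) ≤ a ⬝ᵥ (S x *ᵥ a)

/-! ### The population measure -/

theorem Admissible.volume_ac (H : Admissible q S c) : volume ≪ population q :=
  withDensity_absolutelyContinuous' H.cont.measurable.ennreal_ofReal.aemeasurable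
    (Eventually.of_forall fun x => by simpa using H.pos x)

theorem population_ac (q : State n → ℝ) : population q ≪ volume :=
  withDensity_absolutelyContinuous _ _

theorem Admissible.lintegral_population (H : Admissible q S c) {f : State n → ENNReal} :
    ∫⁻ x, f x ∂population q = ∫⁻ x, ENNReal.ofReal (q x) * f x := by
  rw [population, lintegral_withDensity_eq_lintegral_mul_non_measurable _
    H.cont.measurable.ennreal_ofReal (by simp)]
  rfl

theorem Admissible.integrable_population_iff (H : Admissible q S c) {f : State n → ℝ} :
    Integrable f (population q) ↔ Integrable fun x => f x * q x := by
  rw [population, integrable_withDensity_iff H.cont.measurable.ennreal_ofReal (by simp)]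
  simp only [ENNReal.toReal_ofReal (H.pos _).le]

theorem Admissible.integral_population (H : Admissible q S c) (f : State n → ℝ) :
    ∫ x, f x ∂population q = ∫ x, f x * q x := by
  rw [population, integral_withDensity_eq_integral_toReal_smul
    H.cont.measurable.ennreal_ofReal (by simp)]
  simp only [ENNReal.toReal_ofReal (H.pos _).le, smul_eq_mul, mul_comm]

theorem inner_self_eq_integral (φ : L2 q) :
    inner ℝ φ φ = ∫ x, φ x ^ 2 ∂population q := by
  rw [L2.inner_def]
  simp [pow_two]

theorem integrable_sq (φ : L2 q) : Integrable (fun x => φ x ^ 2) (population q) :=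
  (Lp.memLp φ).integrable_sq

/-! ### Local integrability -/

theorem Admissible.exists_lower_bound (H : Admissible q S c) {K : Set (State n)}
    (hK : IsCompact K) : ∃ m, 0 < m ∧ ∀ x ∈ K, m ≤ q x := by
  rcases K.eq_empty_or_nonempty with rfl | hne
  · exact ⟨1, one_pos, by simp⟩
  · obtain ⟨x, -, hx⟩ := hK.exists_isMinOn hne H.cont.continuousOn
    exact ⟨q x, H.pos x, fun y hy => hx hy⟩

/-- `L²(Q)` lies in `L¹(Q)` since `Q` is finite, and on a compact set the positive lower bound of
`q` compares Lebesgue integrals with `Q`-integrals. -/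
theorem Admissible.locallyIntegrable (H : Admissible q S c) {E : Type*} [NormedAddCommGroup E]
    {f : State n → E} (hf : MemLp f 2 (population q)) : LocallyIntegrable f := by
  have := H.prob
  rw [locallyIntegrable_iff]
  intro K hK
  obtain ⟨m, hm, hmK⟩ := H.exists_lower_bound hK
  have h1 : Integrable f (population q) := hf.integrable (by norm_num)
  refine ⟨(h1.1.mono_ac H.volume_ac).restrict, ?_⟩
  have h2 := h1.2
  rw [HasFiniteIntegral, H.lintegral_population] at h2
  have h3 : ENNReal.ofReal m * ∫⁻ x in K, ‖f x‖ₑ < ⊤ := by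
    refine lt_of_le_of_lt ?_ h2
    rw [← lintegral_const_mul' _ _ (by simp)]
    refine (setLIntegral_mono' hK.measurableSet fun x hx => ?_).trans (setLIntegral_le_lintegral _ _)
    gcongr
    exact hmK x hx
  rcases ENNReal.mul_lt_top_iff.1 h3 with h | h | h
  · exact h.2
  · simp [hm.not_ge] at h
  · rw [HasFiniteIntegral, h]; simp

theorem Admissible.locallyIntegrable_L2 (H : Admissible q S c) (φ : L2 q) :
    LocallyIntegrable φ := H.locallyIntegrable (Lp.memLp φ)

/-! ### Weak gradients -/

theorem continuous_partialDeriv {u : State n → ℝ} (hu : ContDiff ℝ 1 u) (i : Fin n) :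
    Continuous (partialDeriv i u) :=
  (hu.continuous_fderiv (by norm_num)).clm_apply continuous_const

theorem hasCompactSupport_partialDeriv {u : State n → ℝ} (hu : HasCompactSupport u) (i : Fin n) :
    HasCompactSupport (partialDeriv i u) :=
  (hu.fderiv ℝ).comp_left (g := fun L : State n →L[ℝ] ℝ => L (EuclideanSpace.single i 1)) (by simp)

theorem integrable_mul_test {φ u : State n → ℝ} (hφ : LocallyIntegrable φ) (hu : Continuous u)
    (hc : HasCompactSupport u) : Integrable fun x => φ x * u x :=
  hφ.integrable_smul_right_of_hasCompactSupport hu hc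

theorem locallyIntegrable_coord {g : State n → State n} (hg : LocallyIntegrable g) (i : Fin n) :
    LocallyIntegrable fun x => g x i := by
  rw [locallyIntegrable_iff] at hg ⊢
  intro K hK
  exact (EuclideanSpace.proj (𝕜 := ℝ) i).integrable_comp (hg K hK)

theorem IsWeakGradient.congr {φ φ' : State n → ℝ} {g : State n → State n}
    (h : IsWeakGradient φ g) (hφ : φ =ᵐ[volume] φ') : IsWeakGradient φ' g := by
  refine ⟨h.1.congr hφ, h.2.1, fun u hu hc i => ?_⟩
  rw [← h.2.2 u hu hc i]
  exact integral_congr_ae (by filter_upwards [hφ] with x hx; rw [hx])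

theorem IsWeakGradient.add {φ φ' : State n → ℝ} {g g' : State n → State n}
    (h : IsWeakGradient φ g) (h' : IsWeakGradient φ' g') : IsWeakGradient (φ + φ') (g + g') := by
  refine ⟨h.1.add h'.1, h.2.1.add h'.2.1, fun u hu hc i => ?_⟩
  have e1 := integrable_mul_test h.1 (continuous_partialDeriv hu i)
    (hasCompactSupport_partialDeriv hc i)
  have e2 := integrable_mul_test h'.1 (continuous_partialDeriv hu i)
    (hasCompactSupport_partialDeriv hc i)
  have e3 := integrable_mul_test (locallyIntegrable_coord h.2.1 i) hu.continuous hc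
  have e4 := integrable_mul_test (locallyIntegrable_coord h'.2.1 i) hu.continuous hc
  simp only [Pi.add_apply, PiLp.add_apply, add_mul]
  rw [integral_add e1 e2, integral_add e3 e4, h.2.2 u hu hc i, h'.2.2 u hu hc i]
  ring

theorem IsWeakGradient.const_smul {φ : State n → ℝ} {g : State n → State n}
    (h : IsWeakGradient φ g) (a : ℝ) : IsWeakGradient (a • φ) (a • g) := by
  refine ⟨h.1.smul a, h.2.1.smul a, fun u hu hc i => ?_⟩
  simp only [Pi.smul_apply, PiLp.smul_apply, smul_eq_mul, mul_assoc]
  rw [integral_const_mul, integral_const_mul, h.2.2 u hu hc i]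
  ring

/-- This makes the choice inside `weakGrad` harmless: the form may be computed from any weak
gradient. -/
theorem IsWeakGradient.ae_unique {φ : State n → ℝ} {g g' : State n → State n}
    (h : IsWeakGradient φ g) (h' : IsWeakGradient φ g') : g =ᵐ[volume] g' := by
  have key : ∀ i : Fin n, ∀ᵐ x, g x i = g' x i := fun i => by
    refine ae_eq_of_integral_contDiff_smul_eq (locallyIntegrable_coord h.2.1 i)
      (locallyIntegrable_coord h'.2.1 i) fun u hu hc => ?_
    have hu1 : ContDiff ℝ 1 u := hu.of_le (by exact_mod_cast le_top)
    have e1 := h.2.2 u hu1 hc i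
    have e2 := h'.2.2 u hu1 hc i
    simp only [smul_eq_mul, mul_comm (u _)]
    linarith
  filter_upwards [ae_all_iff.2 key] with x hx
  ext i
  exact hx i

theorem isWeakGradient_zero : IsWeakGradient (0 : State n → ℝ) (0 : State n → State n) :=
  ⟨locallyIntegrable_zero, locallyIntegrable_zero, fun u _ _ i => by simp⟩

/-! ### The energy density -/

theorem energyDensity_nonneg (H : Admissible q S c) (g : State n → State n) (x : State n) :
    0 ≤ energyDensity q S g g x := by
  refine mul_nonneg (le_trans ?_ (H.ell x _)) (H.pos x).le
  exact mul_nonneg H.ell_pos.le (by simpa using dotProduct_star_self_nonneg (g x).ofLp)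

theorem dotProduct_self_eq_norm_sq (a : State n) : a.ofLp ⬝ᵥ a.ofLp = ‖a‖ ^ 2 := by
  rw [EuclideanSpace.real_norm_sq_eq]
  simp [dotProduct, pow_two]

theorem energyDensity_lower (H : Admissible q S c) (g : State n → State n) (x : State n) :
    c * ‖g x‖ ^ 2 * q x ≤ energyDensity q S g g x := by
  rw [← dotProduct_self_eq_norm_sq]
  exact mul_le_mul_of_nonneg_right (H.ell x _) (H.pos x).le

/-- The cross terms cancel, so symmetry of `S x` plays no role. This identity stands in for
bilinearity: the later arguments use only diagonal values of the form. -/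
theorem energyDensity_parallelogram (g g' : State n → State n) (x : State n) :
    energyDensity q S (g + g') (g + g') x + energyDensity q S (g - g') (g - g') x =
      2 * energyDensity q S g g x + 2 * energyDensity q S g' g' x := by
  simp only [energyDensity, Pi.add_apply, Pi.sub_apply, WithLp.ofLp_add, WithLp.ofLp_sub,
    Matrix.mulVec_add, Matrix.mulVec_sub, add_dotProduct, sub_dotProduct, dotProduct_add,
    dotProduct_sub]
  ring

theorem energyDensity_smul (a : ℝ) (g : State n → State n) (x : State n) :
    energyDensity q S (a • g) (a • g) x = a ^ 2 * energyDensity q S g g x := by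
  simp only [energyDensity, Pi.smul_apply, WithLp.ofLp_smul, Matrix.mulVec_smul, smul_dotProduct,
    dotProduct_smul, smul_eq_mul]
  ring

theorem measurable_energyDensity (H : Admissible q S c) {g : State n → State n}
    (hg : Measurable g) : Measurable (energyDensity q S g g) := by
  have hq := H.cont.measurable
  have hS := fun i j => (H.coeff_cont i j).measurable
  have hgi : ∀ i, Measurable fun x => g x i := fun i =>
    (EuclideanSpace.proj (𝕜 := ℝ) i).continuous.measurable.comp hg
  unfold energyDensity dotProduct Matrix.mulVec dotProduct
  fun_prop

theorem integrable_energyDensity_add_sub (H : Admissible q S c) {g g' : State n → State n}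
    (hg : Measurable g) (hg' : Measurable g') (h : Integrable (energyDensity q S g g))
    (h' : Integrable (energyDensity q S g' g')) :
    Integrable (energyDensity q S (g + g') (g + g')) ∧
      Integrable (energyDensity q S (g - g') (g - g')) := by
  have hb := (h.const_mul 2).add (h'.const_mul 2)
  constructor
  · refine hb.mono' (measurable_energyDensity H (hg.add hg')).aestronglyMeasurable
      (Eventually.of_forall fun x => ?_)
    rw [Real.norm_of_nonneg (energyDensity_nonneg H _ x)]
    have := energyDensity_parallelogram (q := q) (S := S) g g' x
    have := energyDensity_nonneg H (g - g') x
    simp only [Pi.add_apply]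
    linarith
  · refine hb.mono' (measurable_energyDensity H (hg.sub hg')).aestronglyMeasurable
      (Eventually.of_forall fun x => ?_)
    rw [Real.norm_of_nonneg (energyDensity_nonneg H _ x)]
    have := energyDensity_parallelogram (q := q) (S := S) g g' x
    have := energyDensity_nonneg H (g + g') x
    simp only [Pi.add_apply]
    linarith

/-! ### The form domain -/

theorem IsFormGradient.add (H : Admissible q S c) {φ φ' : L2 q} {g g' : State n → State n}
    (h : IsFormGradient q S φ g) (h' : IsFormGradient q S φ' g') :
    IsFormGradient q S (φ + φ') (g + g') := by
  refine ⟨h.1.add h'.1, (h.2.1.add h'.2.1).congr ?_,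
    (integrable_energyDensity_add_sub H h.1 h'.1 h.2.2 h'.2.2).1⟩
  exact H.volume_ac.ae_le (Lp.coeFn_add φ φ').symm

theorem IsFormGradient.const_smul (H : Admissible q S c) {φ : L2 q} {g : State n → State n}
    (h : IsFormGradient q S φ g) (a : ℝ) : IsFormGradient q S (a • φ) (a • g) := by
  refine ⟨h.1.const_smul a, (h.2.1.const_smul a).congr (H.volume_ac.ae_le (Lp.coeFn_smul a φ).symm),
    (h.2.2.const_mul (a ^ 2)).congr (Eventually.of_forall fun x => ?_)⟩
  exact (energyDensity_smul a g x).symm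

theorem IsFormGradient.sub (H : Admissible q S c) {φ φ' : L2 q} {g g' : State n → State n}
    (h : IsFormGradient q S φ g) (h' : IsFormGradient q S φ' g') :
    IsFormGradient q S (φ - φ') (g - g') := by
  have := h.add H (h'.const_smul H (-1))
  simpa [← sub_eq_add_neg] using this

theorem isFormGradient_zero (H : Admissible q S c) :
    IsFormGradient q S (0 : L2 q) (0 : State n → State n) := by
  refine ⟨measurable_zero, isWeakGradient_zero.congr ?_, ?_⟩
  · exact H.volume_ac.ae_le (Lp.coeFn_zero ℝ 2 (population q)).symm
  · have : energyDensity q S (0 : State n → State n) 0 = 0 := by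
      ext x; simp [energyDensity]
    rw [this]; exact integrable_zero _ _ _

theorem IsFormGradient.ae_unique {φ : L2 q} {g g' : State n → State n}
    (h : IsFormGradient q S φ g) (h' : IsFormGradient q S φ g') : g =ᵐ[volume] g' :=
  h.2.1.ae_unique h'.2.1

theorem isFormGradient_weakGrad {φ : L2 q} (h : φ ∈ formDomain q S) :
    IsFormGradient q S φ (weakGrad q S φ) := by
  have h' : ∃ g, IsFormGradient q S φ g := h
  rw [weakGrad, dif_pos h']
  exact h'.choose_spec

theorem integral_energyDensity_congr {g g' : State n → State n} (h : g =ᵐ[volume] g') :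
    ∫ x, energyDensity q S g g x = ∫ x, energyDensity q S g' g' x :=
  integral_congr_ae (by filter_upwards [h] with x hx; simp only [energyDensity, hx])

theorem IsFormGradient.form_eq {φ : L2 q} {g : State n → State n} (h : IsFormGradient q S φ g) :
    form q S φ φ = (1 / 2) * ∫ x, energyDensity q S g g x := by
  rw [form, integral_energyDensity_congr ((isFormGradient_weakGrad ⟨g, h⟩).ae_unique h)]

/-- The form domain as a linear subspace. -/
def formSubmodule (H : Admissible q S c) : Submodule ℝ (L2 q) where
  carrier := formDomain q S
  zero_mem' := ⟨0, isFormGradient_zero H⟩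
  add_mem' := fun ⟨g, hg⟩ ⟨g', hg'⟩ => ⟨g + g', hg.add H hg'⟩
  smul_mem' := fun a _ ⟨g, hg⟩ => ⟨a • g, hg.const_smul H a⟩

theorem form_self_nonneg (H : Admissible q S c) (φ : L2 q) : 0 ≤ form q S φ φ :=
  mul_nonneg (by norm_num) (integral_nonneg fun x => energyDensity_nonneg H _ x)

theorem form_self_smul (H : Admissible q S c) {φ : L2 q} (h : φ ∈ formDomain q S) (a : ℝ) :
    form q S (a • φ) (a • φ) = a ^ 2 * form q S φ φ := by
  have hg := isFormGradient_weakGrad h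
  rw [(hg.const_smul H a).form_eq, hg.form_eq]
  simp only [energyDensity_smul]
  rw [integral_const_mul]
  ring

theorem form_self_parallelogram (H : Admissible q S c) {φ ψ : L2 q} (h : φ ∈ formDomain q S)
    (h' : ψ ∈ formDomain q S) :
    form q S (φ + ψ) (φ + ψ) + form q S (φ - ψ) (φ - ψ) =
      2 * form q S φ φ + 2 * form q S ψ ψ := by
  have hg := isFormGradient_weakGrad h
  have hg' := isFormGradient_weakGrad h'
  have hi := integrable_energyDensity_add_sub H hg.1 hg'.1 hg.2.2 hg'.2.2
  rw [(hg.add H hg').form_eq, (hg.sub H hg').form_eq, hg.form_eq, hg'.form_eq, ← mul_add,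
    ← integral_add hi.1 hi.2]
  simp only [energyDensity_parallelogram]
  rw [integral_add (hg.2.2.const_mul 2) (hg'.2.2.const_mul 2), integral_const_mul,
    integral_const_mul]
  ring

/-! ### Closedness of the form -/

/-- Integrating against `w` for Lebesgue measure is pairing in `L²(Q)` with `(w / q) • v`, which is
continuous with compact support. Weak-gradient identities therefore survive `L²(Q)` limits. -/
theorem Admissible.tendsto_integral_inner_test (H : Admissible q S c) {E : Type*}
    [NormedAddCommGroup E] [InnerProductSpace ℝ E]
    {F : ℕ → Lp E 2 (population q)} {F₀ : Lp E 2 (population q)} (hF : Tendsto F atTop (𝓝 F₀))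
    {w : State n → ℝ} (hw : Continuous w) (hc : HasCompactSupport w) (v : E) :
    Tendsto (fun k => ∫ x, inner ℝ v (F k x) * w x) atTop (𝓝 (∫ x, inner ℝ v (F₀ x) * w x)) := by
  have := H.prob
  have hmem : MemLp (fun x => (w x / q x) • v) 2 (population q) := by
    refine Continuous.memLp_of_hasCompactSupport ?_ ?_
    · exact (hw.div H.cont fun x => (H.pos x).ne').smul continuous_const
    · refine hc.mono fun x hx => ?_
      contrapose! hx
      simp only [Function.mem_support, not_not] at hx ⊢
      simp [hx]
  have key : ∀ G : Lp E 2 (population q),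
      inner ℝ (hmem.toLp _) G = ∫ x, inner ℝ v (G x) * w x := fun G => by
    have e : inner ℝ (hmem.toLp _) G = ∫ x, inner ℝ v (G x) * (w x / q x) ∂population q := by
      rw [L2.inner_def]
      refine integral_congr_ae ?_
      filter_upwards [hmem.coeFn_toLp] with x hx
      rw [hx, inner_smul_left]
      simp [mul_comm]
    rw [e, H.integral_population]
    refine integral_congr_ae (Eventually.of_forall fun x => ?_)
    have := (H.pos x).ne'
    simp only
    field_simp
  simp only [← key]
  exact (continuous_const.inner continuous_id).continuousAt.tendsto.comp hF

theorem IsFormGradient.integrable_norm_sq (H : Admissible q S c) {φ : L2 q}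
    {g : State n → State n} (h : IsFormGradient q S φ g) :
    Integrable (fun x => ‖g x‖ ^ 2) (population q) := by
  rw [H.integrable_population_iff]
  have hq := H.cont.measurable
  have hg := h.1
  refine (h.2.2.const_mul c⁻¹).mono' (by fun_prop) (Eventually.of_forall fun x => ?_)
  have h1 := energyDensity_lower H g x
  rw [Real.norm_of_nonneg (mul_nonneg (by positivity) (H.pos x).le), inv_mul_eq_div,
    le_div_iff₀ H.ell_pos]
  linarith

theorem IsFormGradient.memLp (H : Admissible q S c) {φ : L2 q}
    {g : State n → State n} (h : IsFormGradient q S φ g) : MemLp g 2 (population q) :=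
  (memLp_two_iff_integrable_sq_norm h.1.aestronglyMeasurable).2 (h.integrable_norm_sq H)

theorem IsFormGradient.integral_norm_sq_le (H : Admissible q S c) {φ : L2 q}
    {g : State n → State n} (h : IsFormGradient q S φ g) :
    c * ∫ x, ‖g x‖ ^ 2 ∂population q ≤ 2 * form q S φ φ := by
  rw [h.form_eq, H.integral_population, ← integral_const_mul]
  have : ∫ x, c * (‖g x‖ ^ 2 * q x) ≤ ∫ x, energyDensity q S g g x := by
    refine integral_mono (((H.integrable_population_iff).1 (h.integrable_norm_sq H)).const_mul c)
      h.2.2 fun x => ?_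
    simpa [mul_assoc] using energyDensity_lower H g x
  linarith

/-- By ellipticity, energy-Cauchy gradients are Cauchy in `L²(Q; ℝⁿ)`. Their limit is a weak
gradient of `φ₀`, and Fatou along an a.e. convergent subsequence controls the energy of the
difference, although `S` may be unbounded. -/
theorem form_closed (H : Admissible q S c) {φ : ℕ → L2 q} {φ₀ : L2 q}
    (hD : ∀ k, φ k ∈ formDomain q S) (hφ : Tendsto φ atTop (𝓝 φ₀))
    (hC : ∀ ε > 0, ∃ N, ∀ k ≥ N, ∀ l ≥ N, form q S (φ k - φ l) (φ k - φ l) ≤ ε) :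
    φ₀ ∈ formDomain q S ∧
      Tendsto (fun k => form q S (φ k - φ₀) (φ k - φ₀)) atTop (𝓝 0) := by
  set g : ℕ → State n → State n := fun k => weakGrad q S (φ k)
  have hg : ∀ k, IsFormGradient q S (φ k) (g k) := fun k => isFormGradient_weakGrad (hD k)
  have hgk : ∀ k l, IsFormGradient q S (φ k - φ l) (g k - g l) := fun k l => (hg k).sub H (hg l)
  set G : ℕ → Lp (State n) 2 (population q) := fun k => ((hg k).memLp H).toLp (g k)
  have hGg : ∀ k, G k =ᵐ[population q] g k := fun k => MemLp.coeFn_toLp _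
  have hnorm : ∀ k l, c * ‖G k - G l‖ ^ 2 ≤ 2 * form q S (φ k - φ l) (φ k - φ l) := fun k l => by
    refine le_trans (le_of_eq ?_) ((hgk k l).integral_norm_sq_le H)
    rw [← real_inner_self_eq_norm_sq, L2.inner_def]
    congr 1
    refine integral_congr_ae ?_
    filter_upwards [Lp.coeFn_sub (G k) (G l), hGg k, hGg l] with x h1 h2 h3
    rw [real_inner_self_eq_norm_sq, h1, Pi.sub_apply, h2, h3, Pi.sub_apply]
  have hcauchy : CauchySeq G := by
    rw [Metric.cauchySeq_iff]
    intro ε hε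
    obtain ⟨N, hN⟩ := hC (c * ε ^ 2 / 4) (by have := H.ell_pos; positivity)
    refine ⟨N, fun k hk l hl => ?_⟩
    rw [dist_eq_norm]
    have h1 := hnorm k l
    have h2 := hN k hk l hl
    have h3 : ‖G k - G l‖ ^ 2 ≤ ε ^ 2 / 2 := by
      have := H.ell_pos
      refine le_of_mul_le_mul_left ?_ this
      linarith
    refine lt_of_pow_lt_pow_left₀ 2 hε.le (lt_of_le_of_lt h3 ?_)
    have : 0 < ε ^ 2 := by positivity
    linarith
  obtain ⟨G₀, hG₀⟩ := cauchySeq_tendsto_of_complete hcauchy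
  obtain ⟨ns, hns, hae⟩ := (tendstoInMeasure_of_tendsto_Lp hG₀).exists_seq_tendsto_ae
  set g₀ : State n → State n := ⇑G₀
  have hg₀ : Measurable g₀ := (Lp.stronglyMeasurable G₀).measurable
  have hlim : ∀ᵐ x, Tendsto (fun l => g (ns l) x) atTop (𝓝 (g₀ x)) := by
    refine H.volume_ac.ae_le ?_
    filter_upwards [hae, ae_all_iff.2 hGg] with x h1 h2
    simpa only [h2] using h1
  have hEmeas : ∀ k, Measurable (energyDensity q S (g k - g₀) (g k - g₀)) := fun k =>
    measurable_energyDensity H ((hg k).1.sub hg₀)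
  have hfatou : ∀ ε > 0, ∃ N, ∀ k ≥ N,
      ∫⁻ x, ENNReal.ofReal (energyDensity q S (g k - g₀) (g k - g₀) x) ≤ ENNReal.ofReal ε := by
    intro ε hε
    obtain ⟨N, hN⟩ := hC (ε / 2) (by positivity)
    refine ⟨N, fun k hk => ?_⟩
    have e1 : ∫⁻ x, ENNReal.ofReal (energyDensity q S (g k - g₀) (g k - g₀) x) =
        ∫⁻ x, liminf (fun l => ENNReal.ofReal
          (energyDensity q S (g k - g (ns l)) (g k - g (ns l)) x)) atTop := by
      refine lintegral_congr_ae ?_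
      filter_upwards [hlim] with x hx
      symm
      refine Tendsto.liminf_eq (ENNReal.tendsto_ofReal ?_)
      have hcont : Continuous fun a : State n =>
          ((g k x - a).ofLp ⬝ᵥ (S x *ᵥ (g k x - a).ofLp)) * q x := by
        unfold dotProduct Matrix.mulVec dotProduct
        fun_prop
      exact (hcont.tendsto _).comp hx
    rw [e1]
    refine (lintegral_liminf_le fun l => (measurable_energyDensity H
      (hgk k (ns l)).1).ennreal_ofReal).trans ?_
    refine liminf_le_of_frequently_le' (Eventually.frequently ?_)
    filter_upwards [eventually_ge_atTop N] with l hl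
    rw [← ofReal_integral_eq_lintegral_ofReal (hgk k (ns l)).2.2
      (Eventually.of_forall fun x => energyDensity_nonneg H _ x)]
    refine ENNReal.ofReal_le_ofReal ?_
    have h1 := hN k hk (ns l) (hl.trans (hns.id_le l))
    rw [(hgk k (ns l)).form_eq] at h1
    linarith
  have hint : ∀ k, (∫⁻ x, ENNReal.ofReal (energyDensity q S (g k - g₀) (g k - g₀) x)) < ⊤ →
      Integrable (energyDensity q S (g k - g₀) (g k - g₀)) := fun k hk =>
    ⟨(hEmeas k).aestronglyMeasurable, by
      rwa [hasFiniteIntegral_iff_ofReal (Eventually.of_forall fun x => energyDensity_nonneg H _ x)]⟩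
  have hform : IsFormGradient q S φ₀ g₀ := by
    refine ⟨hg₀, ⟨H.locallyIntegrable_L2 φ₀, H.locallyIntegrable (Lp.memLp G₀), ?_⟩, ?_⟩
    · intro u hu hc i
      have t1 := H.tendsto_integral_inner_test hφ (continuous_partialDeriv hu i)
        (hasCompactSupport_partialDeriv hc i) (1 : ℝ)
      have t2 := (H.tendsto_integral_inner_test hG₀ hu.continuous hc
        (EuclideanSpace.single i (1 : ℝ))).neg
      simp only [EuclideanSpace.inner_single_left, map_one, one_mul] at t2
      simp only [RCLike.inner_apply, map_one, mul_one] at t1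
      refine tendsto_nhds_unique t1 (t2.congr fun k => ?_)
      rw [(hg k).2.1.2.2 u hu hc i]
      congr 1
      refine integral_congr_ae ?_
      filter_upwards [H.volume_ac.ae_le (hGg k)] with x hx
      rw [hx]
    -- Finite energy of the limit: `g₀ = g N - (g N - g₀)`, and both terms have finite energy.
    · obtain ⟨N, hN⟩ := hfatou 1 one_pos
      have h1 := hint N ((hN N le_rfl).trans_lt (by simp))
      have h2 := (integrable_energyDensity_add_sub H (hg N).1 ((hg N).1.sub hg₀) (hg N).2.2 h1).2
      simpa using h2
  refine ⟨⟨g₀, hform⟩, ?_⟩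
  rw [Metric.tendsto_atTop]
  intro ε hε
  obtain ⟨N, hN⟩ := hfatou ε hε
  refine ⟨N, fun k hk => ?_⟩
  rw [Real.dist_0_eq_abs, abs_of_nonneg (form_self_nonneg H _), ((hg k).sub H hform).form_eq,
    integral_eq_lintegral_of_nonneg_ae (Eventually.of_forall fun x => energyDensity_nonneg H _ x)
      (hEmeas k).aestronglyMeasurable]
  have := ENNReal.toReal_le_of_le_ofReal hε.le (hN k hk)
  linarith

/-! ### A Poincaré inequality on convex sets -/

theorem lintegral_comp_homothety (G : State n → ENNReal) (hG : Measurable G) (x : State n) {t : ℝ}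
    (ht : 0 < t) :
    ∫⁻ y, G (x + t • (y - x)) = ENNReal.ofReal ((t ^ n)⁻¹) * ∫⁻ y, G y := by
  have e1 : ∀ y, x + t • (y - x) = (x - t • x) + t • y := fun y => by
    rw [smul_sub]; abel
  simp only [e1]
  have h1 : Measurable fun z => G ((x - t • x) + z) := hG.comp (measurable_const_add _)
  have h2 := lintegral_map (μ := (volume : Measure (State n))) h1 (measurable_const_smul t)
  rw [← h2, Measure.map_addHaar_smul _ ht.ne', lintegral_smul_measure, lintegral_add_left_eq_self]
  rw [finrank_euclideanSpace_fin, abs_of_pos (by positivity), smul_eq_mul]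

theorem setLIntegral_comp_homothety_le {K : Set (State n)} (hK : Convex ℝ K)
    (hm : MeasurableSet K) {G : State n → ENNReal} (hG : Measurable G) {x : State n} (hx : x ∈ K)
    {t : ℝ} (ht : 1 / 2 ≤ t) (ht1 : t ≤ 1) :
    ∫⁻ y in K, G (x + t • (y - x)) ≤ 2 ^ n * ∫⁻ y in K, G y := by
  have ht0 : 0 < t := by linarith
  have h1 : ∫⁻ y in K, G (x + t • (y - x)) ≤ ∫⁻ y, K.indicator G (x + t • (y - x)) := by
    refine (setLIntegral_mono' hm fun y hy => ?_).trans (setLIntegral_le_lintegral _ _)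
    rw [Set.indicator_of_mem (hK.add_smul_sub_mem hx hy ⟨ht0.le, ht1⟩)]
  refine h1.trans ?_
  rw [lintegral_comp_homothety _ (hG.indicator hm) x ht0, lintegral_indicator hm]
  gcongr
  have : (t ^ n)⁻¹ ≤ (2 : ℝ) ^ n := by
    rw [← inv_pow]
    gcongr
    rw [inv_le_comm₀ ht0 (by norm_num)]
    linarith
  refine (ENNReal.ofReal_le_ofReal this).trans ?_
  rw [ENNReal.ofReal_pow (by norm_num)]
  simp

/-- The Jacobian factor `t⁻ⁿ` of the homothety centred at `x` blows up as `t → 0`. For `t ≤ 1/2`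
exchange `x` and `y`, which replaces `t` by `1 - t ≥ 1/2`; so `2 ^ n` always suffices. -/
theorem lintegral_lintegral_segment_le {K : Set (State n)} (hK : Convex ℝ K)
    (hm : MeasurableSet K) {G : State n → ENNReal} (hG : Measurable G) {t : ℝ} (ht0 : 0 ≤ t)
    (ht1 : t ≤ 1) :
    ∫⁻ x in K, ∫⁻ y in K, G (x + t • (y - x)) ≤ 2 ^ n * volume K * ∫⁻ y in K, G y := by
  have key : ∀ s : ℝ, 1 / 2 ≤ s → s ≤ 1 →
      ∫⁻ x in K, ∫⁻ y in K, G (x + s • (y - x)) ≤ 2 ^ n * volume K * ∫⁻ y in K, G y := by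
    intro s hs hs1
    refine (setLIntegral_mono' hm fun x hx =>
      setLIntegral_comp_homothety_le hK hm hG hx hs hs1).trans ?_
    rw [setLIntegral_const]
    exact le_of_eq (by ring)
  rcases le_total (1 / 2) t with h | h
  · exact key t h ht1
  · rw [lintegral_lintegral_swap (by fun_prop)]
    have e : ∀ x y : State n, x + t • (y - x) = y + (1 - t) • (x - y) := fun x y => by
      rw [smul_sub, smul_sub, sub_smul, sub_smul]; simp; abel
    simp only [e]
    exact key (1 - t) (by linarith) (by linarith)

/-- The variance of `f` on the unit interval is nonnegative. -/
theorem sq_intervalIntegral_le {f : ℝ → ℝ} (hf : Continuous f) :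
    (∫ t in (0 : ℝ)..1, f t) ^ 2 ≤ ∫ t in (0 : ℝ)..1, f t ^ 2 := by
  set a := ∫ t in (0 : ℝ)..1, f t
  have h : 0 ≤ ∫ t in (0 : ℝ)..1, (f t - a) ^ 2 :=
    intervalIntegral.integral_nonneg zero_le_one fun t _ => sq_nonneg _
  have e : ∫ t in (0 : ℝ)..1, (f t - a) ^ 2 = (∫ t in (0 : ℝ)..1, f t ^ 2) - a ^ 2 := by
    have e1 : ∀ t, (f t - a) ^ 2 = f t ^ 2 - 2 * a * f t + a ^ 2 := fun t => by ring
    simp only [e1]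
    rw [intervalIntegral.integral_add, intervalIntegral.integral_sub,
      intervalIntegral.integral_const_mul, intervalIntegral.integral_const]
    · simp only [sub_zero, smul_eq_mul, one_mul]
      change _ - 2 * a * a + a ^ 2 = _
      ring
    all_goals exact Continuous.intervalIntegrable (by fun_prop) _ _
  linarith

theorem sq_sub_le_lintegral_segment {w : State n → ℝ} (hw : ContDiff ℝ 1 w) {d : ℝ}
    {x y : State n} (hxy : ‖y - x‖ ≤ d) :
    ENNReal.ofReal ((w y - w x) ^ 2) ≤ ENNReal.ofReal (d ^ 2) *
      ∫⁻ t in Set.Ioc (0 : ℝ) 1, ENNReal.ofReal (‖fderiv ℝ w (x + t • (y - x))‖ ^ 2) := by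
  have hcf : Continuous (fderiv ℝ w) := hw.continuous_fderiv (by norm_num)
  have hcont : Continuous fun t : ℝ => fderiv ℝ w (x + t • (y - x)) (y - x) := by fun_prop
  have hder : ∀ t ∈ Set.uIcc (0 : ℝ) 1, HasDerivAt (fun t : ℝ => w (x + t • (y - x)))
      (fderiv ℝ w (x + t • (y - x)) (y - x)) t := fun t _ => by
    have h1 : HasDerivAt (fun t : ℝ => x + t • (y - x)) (y - x) t := by
      simpa using ((hasDerivAt_id t).smul_const (y - x)).const_add x
    exact ((hw.differentiable (by norm_num)) _).hasFDerivAt.comp_hasDerivAt t h1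
  have hftc := intervalIntegral.integral_eq_sub_of_hasDerivAt hder
    (hcont.intervalIntegrable 0 1)
  simp only [one_smul, add_sub_cancel, zero_smul, add_zero] at hftc
  have h2 : (w y - w x) ^ 2 ≤ d ^ 2 * ∫ t in (0 : ℝ)..1, ‖fderiv ℝ w (x + t • (y - x))‖ ^ 2 := by
    rw [← hftc, ← intervalIntegral.integral_const_mul]
    refine (sq_intervalIntegral_le hcont).trans ?_
    refine intervalIntegral.integral_mono_on zero_le_one
      (Continuous.intervalIntegrable (by fun_prop) _ _)
      (Continuous.intervalIntegrable (by fun_prop) _ _) fun t _ => ?_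
    have hle : |fderiv ℝ w (x + t • (y - x)) (y - x)| ≤ d * ‖fderiv ℝ w (x + t • (y - x))‖ := by
      rw [mul_comm]
      exact ((fderiv ℝ w (x + t • (y - x))).le_opNorm (y - x)).trans (by gcongr)
    rw [← mul_pow, ← sq_abs]
    gcongr
  refine (ENNReal.ofReal_le_ofReal h2).trans (le_of_eq ?_)
  rw [ENNReal.ofReal_mul (sq_nonneg d), intervalIntegral.integral_of_le zero_le_one,
    ofReal_integral_eq_lintegral_ofReal]
  · exact (Continuous.intervalIntegrable (by fun_prop) 0 1).1
  · exact Eventually.of_forall fun t => by positivity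

/-- Write `w y - w x` as an integral of the derivative along the segment, apply Cauchy-Schwarz, and
use Tonelli to integrate over the pair `(x, y)` before the segment parameter. -/
theorem poincare_double {K : Set (State n)} (hK : Convex ℝ K) (hm : MeasurableSet K) {d : ℝ}
    (hd : ∀ x ∈ K, ∀ y ∈ K, ‖y - x‖ ≤ d) {w : State n → ℝ} (hw : ContDiff ℝ 1 w) :
    ∫⁻ x in K, ∫⁻ y in K, ENNReal.ofReal ((w y - w x) ^ 2) ≤
      ENNReal.ofReal (2 ^ n * d ^ 2) * volume K *
        ∫⁻ y in K, ENNReal.ofReal (‖fderiv ℝ w y‖ ^ 2) := by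
  have hcf : Continuous (fderiv ℝ w) := hw.continuous_fderiv (by norm_num)
  set G : State n → ENNReal := fun y => ENNReal.ofReal (‖fderiv ℝ w y‖ ^ 2)
  have hG : Continuous G := ENNReal.continuous_ofReal.comp (by fun_prop)
  calc ∫⁻ x in K, ∫⁻ y in K, ENNReal.ofReal ((w y - w x) ^ 2)
      ≤ ∫⁻ x in K, ∫⁻ y in K, ENNReal.ofReal (d ^ 2) *
          ∫⁻ t in Set.Ioc (0 : ℝ) 1, G (x + t • (y - x)) :=
        setLIntegral_mono' hm fun x hx => setLIntegral_mono' hm fun y hy =>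
          sq_sub_le_lintegral_segment hw (hd x hx y hy)
    _ = ENNReal.ofReal (d ^ 2) * ∫⁻ x in K, ∫⁻ y in K,
          ∫⁻ t in Set.Ioc (0 : ℝ) 1, G (x + t • (y - x)) := by
        simp only [lintegral_const_mul' _ _ ENNReal.ofReal_ne_top]
    _ = ENNReal.ofReal (d ^ 2) * ∫⁻ t in Set.Ioc (0 : ℝ) 1, ∫⁻ x in K, ∫⁻ y in K,
          G (x + t • (y - x)) := by
        congr 1
        have e1 : ∀ x, ∫⁻ y in K, ∫⁻ t in Set.Ioc (0 : ℝ) 1, G (x + t • (y - x)) =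
            ∫⁻ t in Set.Ioc (0 : ℝ) 1, ∫⁻ y in K, G (x + t • (y - x)) := fun x =>
          lintegral_lintegral_swap (Continuous.aemeasurable (by fun_prop))
        simp only [e1]
        refine lintegral_lintegral_swap (Measurable.aemeasurable ?_)
        refine Measurable.lintegral_prod_right' (f := fun p : (State n × ℝ) × State n =>
          G (p.1.1 + p.1.2 • (p.2 - p.1.1))) (Continuous.measurable ?_)
        fun_prop
    _ ≤ ENNReal.ofReal (d ^ 2) * ∫⁻ _ in Set.Ioc (0 : ℝ) 1, 2 ^ n * volume K * ∫⁻ y in K, G y := by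
        gcongr 1
        exact setLIntegral_mono' measurableSet_Ioc fun t ht =>
          lintegral_lintegral_segment_le hK hm hG.measurable ht.1.le ht.2
    _ = _ := by
        rw [setLIntegral_const, Real.volume_Ioc, ENNReal.ofReal_mul (p := 2 ^ n) (by positivity),
          ENNReal.ofReal_pow (p := 2) (by norm_num)]
        simp
        ring

/-- The double integral of `(f y - f x) ^ 2` is twice the difference of `μ(univ) ∫ f²` and `(∫ f)²`.
-/
theorem variance_le_of_lintegral_le {α : Type*} [MeasurableSpace α] {μ : Measure α}
    [IsFiniteMeasure μ] {f : α → ℝ} (hf : MemLp f 2 μ) {A : ℝ} (hA : 0 ≤ A)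
    (h : ∫⁻ x, ∫⁻ y, ENNReal.ofReal ((f y - f x) ^ 2) ∂μ ∂μ ≤ ENNReal.ofReal (2 * A)) :
    μ.real Set.univ * ∫ x, f x ^ 2 ∂μ ≤ (∫ x, f x ∂μ) ^ 2 + A := by
  have h1 : Integrable f μ := hf.integrable (by norm_num)
  have h2 : Integrable (fun x => f x ^ 2) μ := hf.integrable_sq
  set I := ∫ x, f x ∂μ
  set J := ∫ x, f x ^ 2 ∂μ
  have ei : ∀ x, Integrable (fun y => (f y - f x) ^ 2) μ := fun x =>
    (hf.sub (memLp_const (f x))).integrable_sq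
  have e1 : ∀ x, ∫ y, (f y - f x) ^ 2 ∂μ = J - 2 * I * f x + μ.real Set.univ * f x ^ 2 := by
    intro x
    have : ∀ y, (f y - f x) ^ 2 = f y ^ 2 - 2 * f x * f y + f x ^ 2 := fun y => by ring
    simp only [this]
    have hs : Integrable (fun y => f y ^ 2 - 2 * f x * f y) μ := h2.sub (h1.const_mul _)
    rw [integral_add hs (integrable_const _),
      integral_sub h2 (h1.const_mul _), integral_const_mul, integral_const, smul_eq_mul]
    change J - 2 * f x * I + _ = _
    ring
  have e2 : ∀ x, ∫⁻ y, ENNReal.ofReal ((f y - f x) ^ 2) ∂μ =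
      ENNReal.ofReal (J - 2 * I * f x + μ.real Set.univ * f x ^ 2) := fun x => by
    rw [← e1, ofReal_integral_eq_lintegral_ofReal (ei x)
      (Eventually.of_forall fun y => sq_nonneg _)]
  have e4 : Integrable (fun x => J - 2 * I * f x) μ := (integrable_const J).sub (h1.const_mul _)
  have e3 : Integrable (fun x => J - 2 * I * f x + μ.real Set.univ * f x ^ 2) μ :=
    e4.add (h2.const_mul _)
  simp only [e2] at h
  rw [← ofReal_integral_eq_lintegral_ofReal e3 (Eventually.of_forall fun x =>
    (integral_nonneg fun y => sq_nonneg _).trans (e1 x).le),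
    ENNReal.ofReal_le_ofReal_iff (by positivity),
    integral_add e4 (h2.const_mul _),
    integral_sub (integrable_const J) (h1.const_mul _), integral_const_mul, integral_const_mul,
    integral_const, smul_eq_mul] at h
  change μ.real Set.univ * J - 2 * I * I + μ.real Set.univ * J ≤ 2 * A at h
  nlinarith

/-! ### Transfer of the Poincaré inequality from Lebesgue measure to `Q` -/

theorem Admissible.setLIntegral_population (H : Admissible q S c) {K : Set (State n)}
    (hm : MeasurableSet K) (f : State n → ENNReal) :
    ∫⁻ x in K, f x ∂population q = ∫⁻ x in K, ENNReal.ofReal (q x) * f x := by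
  rw [population, setLIntegral_withDensity_eq_setLIntegral_mul_non_measurable _
    H.cont.measurable.ennreal_ofReal f hm (by simp)]
  rfl

theorem Admissible.setLIntegral_population_le (H : Admissible q S c) {K : Set (State n)}
    (hm : MeasurableSet K) {M : ℝ} (hM : ∀ x ∈ K, q x ≤ M) (f : State n → ENNReal) :
    ∫⁻ x in K, f x ∂population q ≤ ENNReal.ofReal M * ∫⁻ x in K, f x := by
  rw [H.setLIntegral_population hm, ← lintegral_const_mul' _ _ ENNReal.ofReal_ne_top]
  exact setLIntegral_mono' hm fun x hx => by gcongr; exact hM x hx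

theorem Admissible.le_setLIntegral_population (H : Admissible q S c) {K : Set (State n)}
    (hm : MeasurableSet K) {m : ℝ} (hmq : ∀ x ∈ K, m ≤ q x) (f : State n → ENNReal) :
    ENNReal.ofReal m * ∫⁻ x in K, f x ≤ ∫⁻ x in K, f x ∂population q := by
  rw [H.setLIntegral_population hm, ← lintegral_const_mul' _ _ ENNReal.ofReal_ne_top]
  exact setLIntegral_mono' hm fun x hx => by gcongr; exact hmq x hx

/-- In `(M / m) ^ 2`, each of the two `Q`-integrals in the double integral costs a factor `M`;
returning to `Q` in the volume of `K` and in the gradient integral costs `m⁻¹` each. -/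
theorem Admissible.poincare (H : Admissible q S c) {K : Set (State n)} (hK : Convex ℝ K)
    (hm : MeasurableSet K) {d m M : ℝ} (hm0 : 0 < m) (hd : ∀ x ∈ K, ∀ y ∈ K, ‖y - x‖ ≤ d)
    (hmq : ∀ x ∈ K, m ≤ q x) (hqM : ∀ x ∈ K, q x ≤ M) {w : State n → ℝ} (hw : ContDiff ℝ 1 w)
    (hwc : HasCompactSupport w) :
    (population q).real K * ∫ x in K, w x ^ 2 ∂population q ≤
      (∫ x in K, w x ∂population q) ^ 2 + 2 ^ n * d ^ 2 * (M / m) ^ 2 * (population q).real K *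
        ∫ x in K, ‖fderiv ℝ w x‖ ^ 2 ∂population q := by
  have := H.prob
  have hcf : Continuous (fderiv ℝ w) := hw.continuous_fderiv (by norm_num)
  set μ := (population q).restrict K
  set G : State n → ENNReal := fun y => ENNReal.ofReal (‖fderiv ℝ w y‖ ^ 2)
  set D := ∫ x in K, ‖fderiv ℝ w x‖ ^ 2 ∂population q
  have hDi : Integrable (fun x => ‖fderiv ℝ w x‖ ^ 2) μ := by
    refine Integrable.restrict ?_
    refine Continuous.integrable_of_hasCompactSupport (by fun_prop) ?_
    exact (hwc.fderiv ℝ).comp_left (g := fun L : State n →L[ℝ] ℝ => ‖L‖ ^ 2) (by simp)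
  have hGD : ∫⁻ x in K, G x ∂population q = ENNReal.ofReal D :=
    (ofReal_integral_eq_lintegral_ofReal hDi (Eventually.of_forall fun x => by positivity)).symm
  have hD0 : 0 ≤ D := integral_nonneg fun x => by positivity
  have hwL : MemLp w 2 μ := (hw.continuous.memLp_of_hasCompactSupport hwc).restrict K
  have hr : μ.real Set.univ = (population q).real K := by simp [μ]
  rw [← hr]
  refine (variance_le_of_lintegral_le hwL (A := 2 ^ n * d ^ 2 * (M / m) ^ 2 *
    (population q).real K * D) (by positivity) ?_).trans (by rw [hr])
  rcases K.eq_empty_or_nonempty with rfl | ⟨x₀, hx₀⟩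
  · simp [μ]
  have hM0 : 0 ≤ M := (H.pos x₀).le.trans (hqM x₀ hx₀)
  have e1 : ENNReal.ofReal m * volume K ≤ ENNReal.ofReal ((population q).real K) := by
    have := H.le_setLIntegral_population hm hmq (fun _ => 1)
    simpa using this
  have e2 : ENNReal.ofReal m * ∫⁻ x in K, G x ≤ ENNReal.ofReal D :=
    (H.le_setLIntegral_population hm hmq G).trans hGD.le
  have e0 : ENNReal.ofReal m⁻¹ * ENNReal.ofReal m = 1 := by
    rw [← ENNReal.ofReal_mul (by positivity), inv_mul_cancel₀ hm0.ne', ENNReal.ofReal_one]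
  have e1' : volume K ≤ ENNReal.ofReal m⁻¹ * ENNReal.ofReal ((population q).real K) := by
    calc volume K = ENNReal.ofReal m⁻¹ * (ENNReal.ofReal m * volume K) := by
          rw [← mul_assoc, e0, one_mul]
      _ ≤ _ := by gcongr
  have e2' : ∫⁻ x in K, G x ≤ ENNReal.ofReal m⁻¹ * ENNReal.ofReal D := by
    calc ∫⁻ x in K, G x = ENNReal.ofReal m⁻¹ * (ENNReal.ofReal m * ∫⁻ x in K, G x) := by
          rw [← mul_assoc, e0, one_mul]
      _ ≤ _ := by gcongr
  calc ∫⁻ x, ∫⁻ y, ENNReal.ofReal ((w y - w x) ^ 2) ∂μ ∂μ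
      ≤ ENNReal.ofReal M * ∫⁻ x in K, ENNReal.ofReal M *
          ∫⁻ y in K, ENNReal.ofReal ((w y - w x) ^ 2) :=
        (H.setLIntegral_population_le hm hqM _).trans (by
          gcongr
          exact H.setLIntegral_population_le hm hqM _)
    _ = ENNReal.ofReal M * (ENNReal.ofReal M *
          ∫⁻ x in K, ∫⁻ y in K, ENNReal.ofReal ((w y - w x) ^ 2)) := by
        rw [lintegral_const_mul' _ _ ENNReal.ofReal_ne_top]
    _ ≤ ENNReal.ofReal M * (ENNReal.ofReal M * (ENNReal.ofReal (2 ^ n * d ^ 2) *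
          (ENNReal.ofReal m⁻¹ * ENNReal.ofReal ((population q).real K)) *
            (ENNReal.ofReal m⁻¹ * ENNReal.ofReal D))) := by
        gcongr
        exact (poincare_double hK hm hd hw).trans (by gcongr)
    _ = ENNReal.ofReal (M * (M * (2 ^ n * d ^ 2 * (m⁻¹ * (population q).real K) *
          (m⁻¹ * D)))) := by
        have hm1 : 0 ≤ m⁻¹ := by positivity
        rw [ENNReal.ofReal_mul hM0, ENNReal.ofReal_mul hM0,
          ENNReal.ofReal_mul (q := m⁻¹ * D) (by positivity),
          ENNReal.ofReal_mul (p := 2 ^ n * d ^ 2) (by positivity), ENNReal.ofReal_mul hm1,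
          ENNReal.ofReal_mul hm1]
    _ ≤ _ := by
        refine ENNReal.ofReal_le_ofReal ?_
        have e : M * (M * (2 ^ n * d ^ 2 * (m⁻¹ * (population q).real K) * (m⁻¹ * D))) =
            2 ^ n * d ^ 2 * (M / m) ^ 2 * (population q).real K * D := by
          rw [div_eq_mul_inv]; ring
        rw [e]
        -- The double integral is at most `A`, whereas only `2 * A` is required; the factor two is
        -- given away.
        have : 0 ≤ 2 ^ n * d ^ 2 * (M / m) ^ 2 * (population q).real K * D := by positivity
        linarith

/-! ### The potential and the energy of test functions -/

/-- The classical gradient, as a vector field. -/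
noncomputable def classicalGrad (w : State n → ℝ) (x : State n) : State n :=
  WithLp.toLp 2 fun i => partialDeriv i w x

theorem contDiff_partialDeriv {u : State n → ℝ} (hu : ContDiff ℝ 2 u) (i : Fin n) :
    ContDiff ℝ 1 (partialDeriv i u) :=
  (hu.fderiv_right (m := 1) (by norm_num)).clm_apply contDiff_const

theorem partialDeriv_mul {u v : State n → ℝ} {x : State n} (hu : DifferentiableAt ℝ u x)
    (hv : DifferentiableAt ℝ v x) (i : Fin n) :
    partialDeriv i (fun y => u y * v y) x =
      u x * partialDeriv i v x + v x * partialDeriv i u x := by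
  simp only [partialDeriv]
  rw [fderiv_fun_mul hu hv]
  simp

theorem partialDeriv_sum {ι : Type*} {s : Finset ι} {u : ι → State n → ℝ} {x : State n}
    (hu : ∀ j ∈ s, DifferentiableAt ℝ (u j) x) (i : Fin n) :
    partialDeriv i (fun y => ∑ j ∈ s, u j y) x = ∑ j ∈ s, partialDeriv i (u j) x := by
  simp only [partialDeriv]
  rw [fderiv_fun_sum hu]
  simp

theorem partialDeriv_density (hq_pos : ∀ x, 0 < q x) (hq : ContDiff ℝ 1 q) (i : Fin n)
    (x : State n) : partialDeriv i q x = -2 * q x * partialDeriv i (logDensity q) x := by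
  have h1 : HasFDerivAt q (fderiv ℝ q x) x := (hq.differentiable (by norm_num) x).hasFDerivAt
  have h2 := (h1.log (hq_pos x).ne').const_mul (-(1 / 2))
  have h3 : fderiv ℝ (logDensity q) x = (-(1 / 2) : ℝ) • (q x)⁻¹ • fderiv ℝ q x := h2.fderiv
  have := (hq_pos x).ne'
  simp only [partialDeriv, h3, smul_apply, smul_eq_mul]
  field_simp

/-- The flux `q Σ ∇h`. -/
noncomputable def flux (q : State n → ℝ) (S : State n → Matrix (Fin n) (Fin n) ℝ) (i : Fin n)
    (x : State n) : ℝ :=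
  q x * ∑ j, S x i j * partialDeriv j (logDensity q) x

theorem contDiff_flux (hq : ContDiff ℝ 1 q) (hS : ∀ i j, ContDiff ℝ 1 fun x => S x i j)
    (hh : ContDiff ℝ 2 (logDensity q)) (i : Fin n) : ContDiff ℝ 1 (flux q S i) :=
  hq.mul (ContDiff.sum fun j _ => (hS i j).mul (contDiff_partialDeriv hh j))

theorem continuous_potential (hS : ∀ i j, ContDiff ℝ 1 fun x => S x i j)
    (hh : ContDiff ℝ 2 (logDensity q)) : Continuous (potential q S) := by
  have h1 := fun i => contDiff_partialDeriv hh i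
  have h2 := fun i => (h1 i).continuous
  have h3 := fun i j => continuous_partialDeriv (h1 j) i
  have h4 := fun i j => continuous_partialDeriv (hS i j) i
  have h5 := fun i j => (hS i j).continuous
  unfold potential
  fun_prop

/-- Differentiating `q` in the flux contributes `-2 q (∇h)'Σ(∇h)`; one half of it completes the
potential and the other is the square term matched in `two_mul_flux_le`. -/
theorem sum_partialDeriv_flux (hq_pos : ∀ x, 0 < q x) (hq : ContDiff ℝ 1 q)
    (hS : ∀ i j, ContDiff ℝ 1 fun x => S x i j) (hh : ContDiff ℝ 2 (logDensity q)) (x : State n) :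
    ∑ i, partialDeriv i (flux q S i) x = -(potential q S x * q x) -
      (∑ i, ∑ j, partialDeriv i (logDensity q) x * S x i j * partialDeriv j (logDensity q) x)
        * q x := by
  have d1 : ∀ j, DifferentiableAt ℝ (partialDeriv j (logDensity q)) x := fun j =>
    (contDiff_partialDeriv hh j).differentiable (by norm_num) x
  have d2 : ∀ i j, DifferentiableAt ℝ (fun y => S y i j) x := fun i j =>
    (hS i j).differentiable (by norm_num) x
  have e : ∀ i, partialDeriv i (flux q S i) x =
      q x * (∑ j, S x i j * partialDeriv i (partialDeriv j (logDensity q)) x) +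
      q x * (∑ j, partialDeriv i (fun y => S y i j) x * partialDeriv j (logDensity q) x) -
      2 * q x * ∑ j, partialDeriv i (logDensity q) x * S x i j *
        partialDeriv j (logDensity q) x := fun i => by
    have d3 : ∀ j ∈ Finset.univ, DifferentiableAt ℝ
        (fun y => S y i j * partialDeriv j (logDensity q) y) x := fun j _ => (d2 i j).mul (d1 j)
    have e0 : partialDeriv i (flux q S i) x = _ :=
      partialDeriv_mul (hq.differentiable (by norm_num) x) (DifferentiableAt.fun_sum d3) i
    rw [e0, partialDeriv_sum d3, partialDeriv_density hq_pos hq]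
    have e1 : ∀ j, partialDeriv i (fun y => S y i j * partialDeriv j (logDensity q) y) x =
        S x i j * partialDeriv i (partialDeriv j (logDensity q)) x +
          partialDeriv i (fun y => S y i j) x * partialDeriv j (logDensity q) x := fun j => by
      rw [partialDeriv_mul (d2 i j) (d1 j)]; ring
    simp only [e1, Finset.sum_add_distrib, mul_assoc, ← Finset.mul_sum]
    ring
  simp only [e, Finset.sum_sub_distrib, Finset.sum_add_distrib, ← Finset.mul_sum, potential]
  ring

/-- Expand `(∇w - w∇h)'Σ(∇w - w∇h) ≥ 0`; symmetry of `Σ` merges the two cross terms. -/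
theorem two_mul_flux_le (H : Admissible q S c) (hsymm : ∀ x i j, S x i j = S x j i)
    (w : State n → ℝ) (x : State n) :
    2 * w x * ∑ i, partialDeriv i w x * flux q S i x - w x ^ 2 *
      (∑ i, ∑ j, partialDeriv i (logDensity q) x * S x i j * partialDeriv j (logDensity q) x)
        * q x ≤ energyDensity q S (classicalGrad w) (classicalGrad w) x := by
  set a : Fin n → ℝ := fun i => partialDeriv i w x
  set b : Fin n → ℝ := fun i => partialDeriv i (logDensity q) x
  have h1 : 0 ≤ ((a - w x • b) ⬝ᵥ (S x *ᵥ (a - w x • b))) * q x := by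
    refine mul_nonneg (le_trans ?_ (H.ell x _)) (H.pos x).le
    exact mul_nonneg H.ell_pos.le (by simpa using dotProduct_star_self_nonneg (a - w x • b))
  have h2 : b ⬝ᵥ (S x *ᵥ a) = a ⬝ᵥ (S x *ᵥ b) := by
    have hT : (S x)ᵀ = S x := by ext i j; exact hsymm x j i
    rw [Matrix.dotProduct_mulVec, ← Matrix.mulVec_transpose, hT, dotProduct_comm]
  have h3 : ∑ i, partialDeriv i w x * flux q S i x = (a ⬝ᵥ (S x *ᵥ b)) * q x := by
    simp only [flux, dotProduct, Matrix.mulVec, Finset.sum_mul]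
    exact Finset.sum_congr rfl fun i _ => by ring
  have h4 : (∑ i, ∑ j, partialDeriv i (logDensity q) x * S x i j *
      partialDeriv j (logDensity q) x) = b ⬝ᵥ (S x *ᵥ b) := by
    simp only [dotProduct, Matrix.mulVec, Finset.mul_sum]
    exact Finset.sum_congr rfl fun i _ => Finset.sum_congr rfl fun j _ => by ring
  have h5 : energyDensity q S (classicalGrad w) (classicalGrad w) x = (a ⬝ᵥ (S x *ᵥ a)) * q x := rfl
  rw [h3, h4, h5]
  simp only [Matrix.mulVec_sub, sub_dotProduct, dotProduct_sub, Matrix.mulVec_smul,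
    smul_dotProduct, dotProduct_smul, smul_eq_mul, h2] at h1
  linarith

theorem continuous_classicalGrad {w : State n → ℝ} (hw : ContDiff ℝ 1 w) :
    Continuous (classicalGrad w) := by
  have := fun i => continuous_partialDeriv hw i
  unfold classicalGrad
  fun_prop

theorem classicalGrad_eq_gradient (w : State n → ℝ) (x : State n) :
    classicalGrad w x = gradient w x := by
  ext i
  have : inner ℝ (gradient w x) (EuclideanSpace.single i (1 : ℝ)) =
      fderiv ℝ w x (EuclideanSpace.single i 1) := by
    rw [gradient, InnerProductSpace.toDual_symm_apply]
  rw [EuclideanSpace.inner_single_right] at this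
  simpa [classicalGrad, partialDeriv] using this.symm

theorem norm_classicalGrad (w : State n → ℝ) (x : State n) :
    ‖classicalGrad w x‖ = ‖fderiv ℝ w x‖ := by
  rw [classicalGrad_eq_gradient, gradient, LinearIsometryEquiv.norm_map]

theorem hasCompactSupport_classicalGrad {w : State n → ℝ} (hc : HasCompactSupport w) :
    HasCompactSupport (classicalGrad w) := by
  refine (hc.fderiv ℝ).mono fun x hx => ?_
  contrapose! hx
  simp only [Function.mem_support, not_not] at hx ⊢
  rw [← norm_eq_zero, norm_classicalGrad, hx, norm_zero]

theorem continuous_energyDensity (H : Admissible q S c) {g : State n → State n}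
    (hg : Continuous g) : Continuous (energyDensity q S g g) := by
  have h2 := H.cont
  have h3 := H.coeff_cont
  unfold energyDensity dotProduct Matrix.mulVec dotProduct
  fun_prop

theorem integrable_energyDensity_classicalGrad (H : Admissible q S c) {w : State n → ℝ}
    (hw : ContDiff ℝ 1 w) (hc : HasCompactSupport w) :
    Integrable (energyDensity q S (classicalGrad w) (classicalGrad w)) := by
  refine Continuous.integrable_of_hasCompactSupport
    (continuous_energyDensity H (continuous_classicalGrad hw)) ?_
  refine (hasCompactSupport_classicalGrad hc).mono fun x hx => ?_
  contrapose! hx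
  simp only [Function.mem_support, not_not] at hx ⊢
  simp [energyDensity, hx]

/-- Integrating the pointwise inequality of `two_mul_flux_le` and moving the derivative from `w²` to
the flux makes the square terms cancel, leaving `V`. Compact support of `w` removes boundary terms.
-/
theorem integral_potential_le (H : Admissible q S c) (hsymm : ∀ x i j, S x i j = S x j i)
    (hq : ContDiff ℝ 1 q) (hS : ∀ i j, ContDiff ℝ 1 fun x => S x i j)
    (hh : ContDiff ℝ 2 (logDensity q)) {w : State n → ℝ} (hw : ContDiff ℝ 1 w)
    (hc : HasCompactSupport w) :
    ∫ x, potential q S x * w x ^ 2 * q x ≤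
      ∫ x, energyDensity q S (classicalGrad w) (classicalGrad w) x := by
  have hF := fun i => contDiff_flux (S := S) hq hS hh i
  have hFc := fun i => (hF i).continuous
  have hF' := fun i => continuous_partialDeriv (hF i) i
  have hwc := hw.continuous
  have hw' := fun i => continuous_partialDeriv hw i
  have hqc := H.cont
  have hSc := H.coeff_cont
  have hVc := continuous_potential hS hh
  have hhc := fun i => (contDiff_partialDeriv hh i).continuous
  have hcs : ∀ f : State n → ℝ, Continuous f → (∀ x, w x = 0 → f x = 0) → Integrable f :=
    fun f hf h0 => hf.integrable_of_hasCompactSupport (hc.mono fun x hx => by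
      contrapose! hx
      simp only [Function.mem_support, not_not] at hx ⊢
      exact h0 x hx)
  have hparts : ∀ i, ∫ x, 2 * w x * (partialDeriv i w x * flux q S i x) =
      -∫ x, partialDeriv i (flux q S i) x * w x ^ 2 := fun i => by
    have hd : ∀ x, fderiv ℝ (fun y => w y ^ 2) x (EuclideanSpace.single i 1) =
        2 * w x * partialDeriv i w x := fun x => by
      have h1 := ((hw.differentiable (by norm_num) x).hasFDerivAt.pow 2).fderiv
      have h2 : fderiv ℝ (fun y => w y ^ 2) x = _ := h1
      rw [h2]
      simp [partialDeriv]
    have h3 := integral_mul_fderiv_eq_neg_fderiv_mul_of_integrable (μ := volume)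
      (f := flux q S i) (g := fun y => w y ^ 2) (v := EuclideanSpace.single i (1 : ℝ))
      (hcs (fun x => partialDeriv i (flux q S i) x * w x ^ 2) (by fun_prop)
        (fun x hx => by simp [hx]))
      (by
        simp only [hd]
        exact hcs _ (by fun_prop) (fun x hx => by simp [hx]))
      (hcs _ (by fun_prop) (fun x hx => by simp [hx]))
      (fun x _ => (hF i).differentiable (by norm_num) x)
      (fun x _ => (hw.pow 2).differentiable (by norm_num) x)
    simp only [hd] at h3
    refine Eq.trans (integral_congr_ae (Eventually.of_forall fun x => ?_)) h3
    simp only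
    ring
  set B : State n → ℝ := fun x =>
    ∑ i, ∑ j, partialDeriv i (logDensity q) x * S x i j * partialDeriv j (logDensity q) x
  have hBc : Continuous B := by fun_prop
  have hi1 : ∀ i, Integrable fun x => 2 * w x * (partialDeriv i w x * flux q S i x) := fun i =>
    hcs _ (by fun_prop) (fun x hx => by simp [hx])
  have hi2 : ∀ i, Integrable fun x => partialDeriv i (flux q S i) x * w x ^ 2 := fun i =>
    hcs _ (by fun_prop) (fun x hx => by simp [hx])
  have hi3 : Integrable fun x => w x ^ 2 * B x * q x :=
    hcs _ (by fun_prop) (fun x hx => by simp [hx])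
  have e1 : ∫ x, potential q S x * w x ^ 2 * q x =
      ∫ x, (2 * w x * (∑ i, partialDeriv i w x * flux q S i x) - w x ^ 2 * B x * q x) := by
    calc ∫ x, potential q S x * w x ^ 2 * q x
        = ∫ x, (-(∑ i, partialDeriv i (flux q S i) x * w x ^ 2) - w x ^ 2 * B x * q x) := by
          refine integral_congr_ae (Eventually.of_forall fun x => ?_)
          simp only
          rw [← Finset.sum_mul, sum_partialDeriv_flux H.pos hq hS hh]
          ring
      _ = _ := by
          simp only [Finset.mul_sum]
          have hn : Integrable fun x => -∑ i, partialDeriv i (flux q S i) x * w x ^ 2 :=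
            (integrable_finsetSum _ fun i _ => hi2 i).neg
          rw [integral_sub hn hi3,
            integral_sub (integrable_finsetSum _ fun i _ => hi1 i) hi3, integral_neg,
            integral_finsetSum _ fun i _ => hi2 i, integral_finsetSum _ fun i _ => hi1 i]
          simp only [hparts, Finset.sum_neg_distrib]
  rw [e1]
  refine integral_mono ?_ (integrable_energyDensity_classicalGrad H hw hc)
    fun x => two_mul_flux_le H hsymm w x
  simp only [Finset.mul_sum]
  exact (integrable_finsetSum _ fun i _ => hi1 i).sub hi3

/-! ### Test functions in the form domain -/

theorem isWeakGradient_classicalGrad {w : State n → ℝ} (hw : ContDiff ℝ 1 w) :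
    IsWeakGradient w (classicalGrad w) := by
  refine ⟨hw.continuous.locallyIntegrable, (continuous_classicalGrad hw).locallyIntegrable,
    fun u hu hc i => ?_⟩
  refine integral_mul_fderiv_eq_neg_fderiv_mul_of_integrable
    (integrable_mul_test (continuous_partialDeriv hw i).locallyIntegrable hu.continuous hc)
    (integrable_mul_test hw.continuous.locallyIntegrable (continuous_partialDeriv hu i)
      (hasCompactSupport_partialDeriv hc i))
    (integrable_mul_test hw.continuous.locallyIntegrable hu.continuous hc)
    (fun x _ => hw.differentiable (by norm_num) x) (fun x _ => hu.differentiable (by norm_num) x)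

theorem isFormGradient_classicalGrad (H : Admissible q S c) {φ : L2 q} {w : State n → ℝ}
    (hw : ContDiff ℝ 1 w) (hc : HasCompactSupport w) (hφ : φ =ᵐ[population q] w) :
    IsFormGradient q S φ (classicalGrad w) :=
  ⟨(continuous_classicalGrad hw).measurable,
    (isWeakGradient_classicalGrad hw).congr (H.volume_ac.ae_le hφ.symm),
    integrable_energyDensity_classicalGrad H hw hc⟩

theorem setIntegral_norm_fderiv_sq_le (H : Admissible q S c) {φ : L2 q} {w : State n → ℝ}
    (hw : ContDiff ℝ 1 w) (hc : HasCompactSupport w) (hφ : φ =ᵐ[population q] w)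
    (K : Set (State n)) :
    ∫ x in K, ‖fderiv ℝ w x‖ ^ 2 ∂population q ≤ 2 / c * form q S φ φ := by
  have hg := isFormGradient_classicalGrad (S := S) H hw hc hφ
  have h1 := hg.integral_norm_sq_le H
  have h2 := hg.integrable_norm_sq H
  simp only [norm_classicalGrad] at h1 h2
  refine (setIntegral_le_integral h2 (Eventually.of_forall fun x => by positivity)).trans ?_
  rw [div_mul_eq_mul_div, le_div_iff₀ H.ell_pos]
  linarith

theorem integrable_test_sq [IsProbabilityMeasure (population q)] {w : State n → ℝ}
    (hw : Continuous w) (hc : HasCompactSupport w) :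
    Integrable (fun x => w x ^ 2) (population q) :=
  (hw.memLp_of_hasCompactSupport hc).integrable_sq

theorem Admissible.exists_upper_bound (H : Admissible q S c) {K : Set (State n)}
    (hK : IsCompact K) : ∃ M, ∀ x ∈ K, q x ≤ M := by
  obtain ⟨M, hM⟩ := hK.bddAbove_image H.cont.continuousOn
  exact ⟨M, fun x hx => hM ⟨x, hx, rfl⟩⟩

/-! ### Partition into small cubes -/

/-- The half-open cube of side `δ` with index `m`. -/
def cube (δ : ℝ) (m : Fin n → ℤ) : Set (State n) :=
  ⋂ i, EuclideanSpace.proj (𝕜 := ℝ) i ⁻¹' Set.Ico (m i * δ) ((m i + 1) * δ)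

theorem mem_cube {δ : ℝ} {m : Fin n → ℤ} {x : State n} :
    x ∈ cube δ m ↔ ∀ i, m i * δ ≤ x i ∧ x i < (m i + 1) * δ := by
  simp [cube]

theorem mem_cube_iff_floor {δ : ℝ} (hδ : 0 < δ) {m : Fin n → ℤ} {x : State n} :
    x ∈ cube δ m ↔ ∀ i, ⌊x i / δ⌋ = m i := by
  rw [mem_cube]
  refine forall_congr' fun i => ?_
  rw [Int.floor_eq_iff, le_div_iff₀ hδ, div_lt_iff₀ hδ]

theorem convex_cube (δ : ℝ) (m : Fin n → ℤ) : Convex ℝ (cube δ m) :=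
  convex_iInter fun i => (convex_Ico _ _).linear_preimage
    (EuclideanSpace.proj (𝕜 := ℝ) i).toLinearMap

theorem measurableSet_cube (δ : ℝ) (m : Fin n → ℤ) : MeasurableSet (cube δ m) :=
  MeasurableSet.iInter fun i =>
    (EuclideanSpace.proj (𝕜 := ℝ) i).continuous.measurable measurableSet_Ico

/-- The sharp bound `√n * δ` is relaxed to `n * δ`; only smallness with `δ` matters. -/
theorem norm_sub_le_of_mem_cube {δ : ℝ} (hδ : 0 < δ) {m : Fin n → ℤ} {x y : State n}
    (hx : x ∈ cube δ m) (hy : y ∈ cube δ m) : ‖y - x‖ ≤ n * δ := by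
  rw [mem_cube] at hx hy
  refine le_of_sq_le_sq ?_ (by positivity)
  have h1 : ∀ i, ((y - x) i) ^ 2 ≤ δ ^ 2 := fun i => by
    have := hx i
    have := hy i
    rw [PiLp.sub_apply]
    refine sq_le_sq' ?_ ?_ <;> linarith
  rw [EuclideanSpace.real_norm_sq_eq]
  calc ∑ i, ((y - x) i) ^ 2 ≤ ∑ _i : Fin n, δ ^ 2 := Finset.sum_le_sum fun i _ => h1 i
    _ = n * δ ^ 2 := by simp
    _ ≤ (n * δ) ^ 2 := by
      rw [mul_pow]
      have : (n : ℝ) ≤ (n : ℝ) ^ 2 := by exact_mod_cast Nat.le_self_pow two_ne_zero n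
      gcongr

theorem disjoint_cube {δ : ℝ} (hδ : 0 < δ) {m m' : Fin n → ℤ} (h : m ≠ m') :
    Disjoint (cube δ m) (cube δ m') := by
  rw [Set.disjoint_left]
  intro x hx hx'
  rw [mem_cube_iff_floor hδ] at hx hx'
  exact h (funext fun i => (hx i).symm.trans (hx' i))

theorem closedBall_subset_iUnion_cube {δ : ℝ} (hδ : 0 < δ) (R : ℝ) :
    Metric.closedBall (0 : State n) R ⊆
      ⋃ m ∈ Fintype.piFinset fun _ : Fin n => Finset.Icc ⌊-R / δ⌋ ⌊R / δ⌋, cube δ m := by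
  intro x hx
  rw [mem_closedBall_zero_iff] at hx
  simp only [Set.mem_iUnion, exists_prop]
  refine ⟨fun i => ⌊x i / δ⌋, ?_, (mem_cube_iff_floor hδ).2 fun i => rfl⟩
  rw [Fintype.mem_piFinset]
  intro i
  have h := abs_le.1 ((PiLp.norm_apply_le x i).trans hx)
  rw [Finset.mem_Icc]
  exact ⟨Int.floor_le_floor (by gcongr; exact h.1), Int.floor_le_floor (by gcongr; exact h.2)⟩

/-- Cutting the ball into convex cells of diameter at most `n * δ` gives a Poincaré constant of
order `δ ^ 2`, with density bounds that depend only on the ball. -/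
theorem local_estimate (H : Admissible q S c) (R : ℝ) {ε : ℝ} (hε : 0 < ε) :
    ∃ (s : Finset (Fin n → ℤ)) (K : (Fin n → ℤ) → Set (State n)), (∀ m, MeasurableSet (K m)) ∧
      ∀ (φ : L2 q) (w : State n → ℝ), ContDiff ℝ 1 w → HasCompactSupport w →
        φ =ᵐ[population q] w →
        ∫ x in Metric.closedBall 0 R, w x ^ 2 ∂population q ≤
          ∑ m ∈ s, (∫ x in K m, w x ∂population q) ^ 2 / (population q).real (K m) +
            ε * form q S φ φ := by
  have := H.prob
  obtain ⟨m, hm0, hm⟩ := H.exists_lower_bound (isCompact_closedBall (0 : State n) R)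
  obtain ⟨M, hM⟩ := H.exists_upper_bound (isCompact_closedBall (0 : State n) R)
  -- `A * δ ^ 2` is the Poincaré constant for diameter `n * δ` times `2 / c`, the price of bounding
  -- the gradient integral by the form.
  set A : ℝ := 2 ^ n * (M / m) ^ 2 * (n : ℝ) ^ 2 * (2 / c) with hA
  have hA0 : 0 ≤ A := by have := H.ell_pos; positivity
  obtain ⟨δ, hδ, hδA⟩ : ∃ δ : ℝ, 0 < δ ∧ A * δ ^ 2 ≤ ε := by
    refine ⟨√(ε / (A + 1)), by positivity, ?_⟩
    rw [Real.sq_sqrt (by positivity), ← mul_div_assoc, div_le_iff₀ (by positivity)]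
    nlinarith
  set s := Fintype.piFinset fun _ : Fin n => Finset.Icc ⌊-R / δ⌋ ⌊R / δ⌋
  set K : (Fin n → ℤ) → Set (State n) := fun k => Metric.closedBall 0 R ∩ cube δ k
  have hKm : ∀ k, MeasurableSet (K k) := fun k =>
    Metric.isClosed_closedBall.measurableSet.inter (measurableSet_cube δ k)
  have hunion : Metric.closedBall (0 : State n) R = ⋃ k ∈ s, K k := by
    rw [← Set.inter_iUnion₂]
    exact (Set.inter_eq_left.2 (closedBall_subset_iUnion_cube hδ R)).symm
  have hdisj : (s : Set (Fin n → ℤ)).PairwiseDisjoint K := fun k _ k' _ hkk' =>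
    (disjoint_cube hδ hkk').mono Set.inter_subset_right Set.inter_subset_right
  refine ⟨s, K, hKm, fun φ w hw hc hφ => ?_⟩
  have hsplit : ∀ f : State n → ℝ, Integrable f (population q) →
      ∫ x in Metric.closedBall 0 R, f x ∂population q =
        ∑ k ∈ s, ∫ x in K k, f x ∂population q := fun f hf => by
    rw [hunion]
    exact integral_biUnion_finset s (fun k _ => hKm k) hdisj fun k _ => hf.integrableOn
  have hgi : Integrable (fun x => ‖fderiv ℝ w x‖ ^ 2) (population q) := by
    have h2 := (isFormGradient_classicalGrad (S := S) H hw hc hφ).integrable_norm_sq H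
    simpa only [norm_classicalGrad] using h2
  have hcube : ∀ k, ∫ x in K k, w x ^ 2 ∂population q ≤
      (∫ x in K k, w x ∂population q) ^ 2 / (population q).real (K k) +
        2 ^ n * (n * δ) ^ 2 * (M / m) ^ 2 * ∫ x in K k, ‖fderiv ℝ w x‖ ^ 2 ∂population q := by
    intro k
    have hp := H.poincare (K := K k) ((convex_closedBall 0 R).inter (convex_cube δ k)) (hKm k) hm0
      (fun x hx y hy => norm_sub_le_of_mem_cube hδ hx.2 hy.2) (fun x hx => hm x hx.1)
      (fun x hx => hM x hx.1) hw hc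
    -- On a null cell every integral vanishes, so the division by zero does no harm.
    rcases (measureReal_nonneg (μ := population q) (s := K k)).eq_or_lt with h0 | h0
    · have h1 : (population q).restrict (K k) = 0 := by
        rw [Measure.restrict_eq_zero]
        exact (measureReal_eq_zero_iff).1 h0.symm
      simp [h1]
    · refine le_of_mul_le_mul_left (hp.trans (le_of_eq ?_)) h0
      have := h0.ne'
      field_simp
  rw [hsplit _ (integrable_test_sq hw.continuous hc)]
  refine (Finset.sum_le_sum fun k _ => hcube k).trans ?_
  rw [Finset.sum_add_distrib, ← Finset.mul_sum, ← hsplit _ hgi]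
  refine add_le_add le_rfl ?_
  calc 2 ^ n * (n * δ) ^ 2 * (M / m) ^ 2 *
        ∫ x in Metric.closedBall 0 R, ‖fderiv ℝ w x‖ ^ 2 ∂population q
      ≤ 2 ^ n * (n * δ) ^ 2 * (M / m) ^ 2 * (2 / c * form q S φ φ) := by
        gcongr
        exact setIntegral_norm_fderiv_sq_le H hw hc hφ _
    _ = A * δ ^ 2 * form q S φ φ := by rw [hA]; ring
    _ ≤ ε * form q S φ φ := by
        gcongr
        exact form_self_nonneg H φ

/-! ### The tail estimate -/

/-- Compare with `∫ V w² q ≤ 2 f(w, w)`: `V ≥ T` outside the ball, and `V ≥ -C` everywhere bounds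
the negative part by the norm. -/
theorem tail_estimate (H : Admissible q S c) (hsymm : ∀ x i j, S x i j = S x j i)
    (hq : ContDiff ℝ 1 q) (hS : ∀ i j, ContDiff ℝ 1 fun x => S x i j)
    (hh : ContDiff ℝ 2 (logDensity q))
    (hV : Tendsto (potential q S) (cocompact (State n)) atTop) {ε : ℝ} (hε : 0 < ε) :
    ∃ R : ℝ, ∀ (φ : L2 q) (w : State n → ℝ), ContDiff ℝ 1 w → HasCompactSupport w →
        φ =ᵐ[population q] w →
        ∫ x in (Metric.closedBall 0 R)ᶜ, w x ^ 2 ∂population q ≤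
          ε * (form q S φ φ + inner ℝ φ φ) := by
  have := H.prob
  have hVc := continuous_potential hS hh
  obtain ⟨C, hC0, hC⟩ : ∃ C : ℝ, 0 ≤ C ∧ ∀ x, -C ≤ potential q S x := by
    have h1 := hV.eventually_ge_atTop 0
    obtain ⟨K, hK, hKV⟩ := mem_cocompact.1 h1
    obtain ⟨b, hb⟩ := hK.bddBelow_image hVc.continuousOn
    refine ⟨|b|, abs_nonneg b, fun x => ?_⟩
    by_cases hx : x ∈ K
    · exact (neg_abs_le b).trans (hb ⟨x, hx, rfl⟩)
    · exact (neg_nonpos.2 (abs_nonneg b)).trans (hKV hx)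
  -- The tail mass times `T` will be at most `2 f + C ⟨φ, φ⟩`, hence at most `(2 + C)(f + ⟨φ, φ⟩)`.
  set T : ℝ := (2 + C) / ε
  have hT0 : 0 < T := by positivity
  obtain ⟨R, hR⟩ : ∃ R : ℝ, ∀ x ∉ Metric.closedBall (0 : State n) R, T ≤ potential q S x := by
    obtain ⟨K, hK, hKV⟩ := mem_cocompact.1 (hV.eventually_ge_atTop T)
    obtain ⟨R, hR⟩ := hK.isBounded.subset_closedBall 0
    exact ⟨R, fun x hx => hKV fun hxK => hx (hR hxK)⟩
  refine ⟨R, fun φ w hw hc hφ => ?_⟩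
  have hw2 := integrable_test_sq (q := q) hw.continuous hc
  have hin : inner ℝ φ φ = ∫ x, w x ^ 2 ∂population q := by
    rw [inner_self_eq_integral]
    exact integral_congr_ae (by filter_upwards [hφ] with x hx; rw [hx])
  have hVi : Integrable (fun x => potential q S x * w x ^ 2) (population q) := by
    have := hw.continuous
    refine Continuous.integrable_of_hasCompactSupport (by fun_prop) (hc.mono fun x hx => ?_)
    contrapose! hx
    simp only [Function.mem_support, not_not] at hx ⊢
    simp [hx]
  have hV2 : ∫ x, potential q S x * w x ^ 2 ∂population q ≤ 2 * form q S φ φ := by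
    rw [(isFormGradient_classicalGrad (S := S) H hw hc hφ).form_eq, H.integral_population]
    have := integral_potential_le H hsymm hq hS hh hw hc
    linarith
  have hT : T * ∫ x in (Metric.closedBall 0 R)ᶜ, w x ^ 2 ∂population q ≤
      ∫ x, (potential q S x * w x ^ 2 + C * w x ^ 2) ∂population q := by
    have hi : Integrable (fun x => potential q S x * w x ^ 2 + C * w x ^ 2) (population q) :=
      hVi.add (hw2.const_mul C)
    rw [← integral_const_mul]
    refine le_trans ?_ (setIntegral_le_integral (s := (Metric.closedBall 0 R)ᶜ) hi
      (Eventually.of_forall fun x => ?_))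
    · refine setIntegral_mono_on (hw2.const_mul T).integrableOn hi.integrableOn
        Metric.isClosed_closedBall.measurableSet.compl fun x hx => ?_
      have h1 := hR x hx
      have h2 := sq_nonneg (w x)
      nlinarith
    · have h1 := hC x
      have h2 := sq_nonneg (w x)
      simp only [Pi.zero_apply]
      nlinarith
  rw [integral_add hVi (hw2.const_mul C), integral_const_mul, ← hin] at hT
  have hf := form_self_nonneg H φ
  have hi : 0 ≤ inner ℝ φ φ := real_inner_self_nonneg
  have e : T * (ε * (form q S φ φ + inner ℝ φ φ)) = (2 + C) * (form q S φ φ + inner ℝ φ φ) := by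
    simp only [T]
    field_simp
  refine le_of_mul_le_mul_left (hT.trans ?_) hT0
  rw [e]
  nlinarith

/-! ### The compactness estimate -/

theorem exists_clm_setIntegral (H : Admissible q S c) {K : Set (State n)} (hK : MeasurableSet K) :
    ∃ L : L2 q →L[ℝ] ℝ, ∀ φ : L2 q, L φ = ∫ x in K, φ x ∂population q := by
  have := H.prob
  exact ⟨innerSL ℝ (indicatorConstLp 2 hK (measure_ne_top _ _) (1 : ℝ)), fun φ => by
    rw [innerSL_apply_apply, L2.inner_indicatorConstLp_one]⟩

theorem setIntegral_congr_population {φ : L2 q} {w : State n → ℝ} (hφ : φ =ᵐ[population q] w)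
    (K : Set (State n)) (f : ℝ → ℝ) :
    ∫ x in K, f (φ x) ∂population q = ∫ x in K, f (w x) ∂population q :=
  integral_congr_ae (ae_restrict_of_ae (by filter_upwards [hφ] with x hx; rw [hx]))

theorem core_estimate (H : Admissible q S c) (hsymm : ∀ x i j, S x i j = S x j i)
    (hq : ContDiff ℝ 1 q) (hS : ∀ i j, ContDiff ℝ 1 fun x => S x i j)
    (hh : ContDiff ℝ 2 (logDensity q))
    (hV : Tendsto (potential q S) (cocompact (State n)) atTop) {ε : ℝ} (hε : 0 < ε) :
    ∃ (s : Finset (Fin n → ℤ)) (L : (Fin n → ℤ) → L2 q →L[ℝ] ℝ), ∀ φ ∈ CK2 q,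
      inner ℝ φ φ ≤ ∑ m ∈ s, L m φ ^ 2 + ε * (form q S φ φ + inner ℝ φ φ) := by
  have := H.prob
  obtain ⟨R, hR⟩ := tail_estimate H hsymm hq hS hh hV (half_pos hε)
  obtain ⟨s, K, hKm, hK⟩ := local_estimate H R (half_pos hε)
  choose L hL using fun m => exists_clm_setIntegral H (hKm m)
  -- The scaling makes the squared functional equal to the cell term `(∫ w)² / Q(K m)`.
  refine ⟨s, fun m => √(((population q).real (K m))⁻¹) • L m, fun φ ⟨w, hw, hc, hφ⟩ => ?_⟩
  have hw1 : ContDiff ℝ 1 w := hw.of_le (by norm_num)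
  have h1 := hR φ w hw1 hc hφ
  have h2 := hK φ w hw1 hc hφ
  have h3 := integral_add_compl (μ := population q)
    (Metric.isClosed_closedBall (x := (0 : State n)) (ε := R)).measurableSet
    (integrable_test_sq hw1.continuous hc)
  have hin : inner ℝ φ φ = ∫ x, w x ^ 2 ∂population q := by
    rw [inner_self_eq_integral]
    exact integral_congr_ae (by filter_upwards [hφ] with x hx; rw [hx])
  have e : ∀ m, (√(((population q).real (K m))⁻¹) • L m) φ ^ 2 =
      (∫ x in K m, w x ∂population q) ^ 2 / (population q).real (K m) := fun m => by
    rw [smul_apply, smul_eq_mul, mul_pow, Real.sq_sqrt (by positivity), hL,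
      setIntegral_congr_population hφ (K m) fun y => y, div_eq_inv_mul]
  simp only [e]
  have hi : 0 ≤ inner ℝ φ φ := real_inner_self_nonneg
  nlinarith

theorem form_self_le (H : Admissible q S c) {φ ψ : L2 q} (h : φ ∈ formDomain q S)
    (h' : ψ ∈ formDomain q S) :
    form q S ψ ψ ≤ 2 * form q S (ψ - φ) (ψ - φ) + 2 * form q S φ φ := by
  have h1 := form_self_parallelogram H ((formSubmodule H).sub_mem h' h : ψ - φ ∈ formDomain q S) h
  have h2 := form_self_nonneg H (ψ - φ - φ)
  rw [sub_add_cancel] at h1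
  linarith

theorem form_self_sub_le (H : Admissible q S c) {φ ψ : L2 q} (h : φ ∈ formDomain q S)
    (h' : ψ ∈ formDomain q S) :
    form q S (φ - ψ) (φ - ψ) ≤ 2 * form q S φ φ + 2 * form q S ψ ψ := by
  have h1 := form_self_parallelogram H h h'
  have h2 := form_self_nonneg H (φ + ψ)
  linarith

theorem IsCore.exists_seq (H : Admissible q S c) {C : Set (L2 q)} (hC : IsCore q S C) {φ : L2 q}
    (h : φ ∈ formDomain q S) : ∃ u : ℕ → L2 q, (∀ k, u k ∈ C) ∧ Tendsto u atTop (𝓝 φ) ∧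
      Tendsto (fun k => form q S (u k - φ) (u k - φ)) atTop (𝓝 0) := by
  obtain ⟨u, hu, hlim⟩ := hC.2 φ h
  have hi : ∀ k, 0 ≤ inner ℝ (u k - φ) (u k - φ) := fun k => real_inner_self_nonneg
  have hf : ∀ k, 0 ≤ form q S (u k - φ) (u k - φ) := fun k => form_self_nonneg H _
  refine ⟨u, hu, ?_, squeeze_zero hf (fun k => by have := hi k; linarith) hlim⟩
  have h1 : Tendsto (fun k => ‖u k - φ‖ ^ 2) atTop (𝓝 0) := by
    refine squeeze_zero (fun k => by positivity) (fun k => ?_) hlim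
    rw [← real_inner_self_eq_norm_sq]
    have := hf k
    linarith
  rw [tendsto_iff_norm_sub_tendsto_zero]
  simpa [Real.sqrt_sq] using h1.sqrt

theorem domain_estimate (H : Admissible q S c) (hsymm : ∀ x i j, S x i j = S x j i)
    (hq : ContDiff ℝ 1 q) (hS : ∀ i j, ContDiff ℝ 1 fun x => S x i j)
    (hh : ContDiff ℝ 2 (logDensity q))
    (hV : Tendsto (potential q S) (cocompact (State n)) atTop) (hcore : IsCore q S (CK2 q))
    {ε : ℝ} (hε : 0 < ε) :
    ∃ (s : Finset (Fin n → ℤ)) (L : (Fin n → ℤ) → L2 q →L[ℝ] ℝ), ∀ φ ∈ formDomain q S,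
      inner ℝ φ φ ≤ ∑ m ∈ s, L m φ ^ 2 + ε * (form q S φ φ + inner ℝ φ φ) := by
  -- The bound `form_self_le` on the approximants loses a factor two, which `ε / 2` absorbs.
  obtain ⟨s, L, hL⟩ := core_estimate H hsymm hq hS hh hV (half_pos hε)
  refine ⟨s, L, fun φ hφ => ?_⟩
  obtain ⟨u, hu, hlim, hform⟩ := hcore.exists_seq H hφ
  have hb : ∀ k, inner ℝ (u k) (u k) ≤ ∑ m ∈ s, L m (u k) ^ 2 + ε / 2 *
      ((2 * form q S (u k - φ) (u k - φ) + 2 * form q S φ φ) + inner ℝ (u k) (u k)) := fun k => by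
    refine (hL _ (hu k)).trans ?_
    gcongr
    exact form_self_le H hφ (hcore.1 (hu k))
  have hin : Tendsto (fun k => inner ℝ (u k) (u k)) atTop (𝓝 (inner ℝ φ φ)) := hlim.inner hlim
  have hsum : Tendsto (fun k => ∑ m ∈ s, L m (u k) ^ 2) atTop (𝓝 (∑ m ∈ s, L m φ ^ 2)) :=
    tendsto_finsetSum _ fun m _ => (((L m).continuous.tendsto φ).comp hlim).pow 2
  have h := le_of_tendsto_of_tendsto' hin (hsum.add ((((hform.const_mul 2).add_const
    (2 * form q S φ φ)).add hin).const_mul (ε / 2))) hb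
  have hi : 0 ≤ inner ℝ φ φ := real_inner_self_nonneg
  nlinarith

/-- Finitely many functionals map `A` to a bounded, hence totally bounded, subset of a
finite-dimensional space; points with nearby images are close in norm. -/
theorem totallyBounded_of_forall_le_sum_sq {E ι : Type u} [NormedAddCommGroup E]
    [InnerProductSpace ℝ E] {A : Set E} (hA : Bornology.IsBounded A)
    (h : ∀ ε > 0, ∃ (s : Finset ι) (L : ι → E →L[ℝ] ℝ), ∀ x ∈ A, ∀ y ∈ A,
      ‖x - y‖ ^ 2 ≤ ∑ m ∈ s, L m (x - y) ^ 2 + ε) : TotallyBounded A := by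
  refine Metric.totallyBounded_of_finite_discretization fun ε hε => ?_
  obtain ⟨s, L, hL⟩ := h (ε ^ 2 / 2) (by positivity)
  set P : E →L[ℝ] (s → ℝ) := ContinuousLinearMap.pi fun m => L m
  have hb : TotallyBounded (P '' A) := ((P.lipschitz.isBounded_image hA).isCompact_closure).totallyBounded.subset subset_closure
  -- Points sharing a net centre have images within `2 * η`, so the functionals contribute at most
  -- `ε ^ 2 / 4` in total. With `ε ^ 2 / 2` from the hypothesis this stays below `ε ^ 2`; the `+ 1`
  -- covers empty `s`.
  set η : ℝ := √(ε ^ 2 / (4 * (s.card + 1))) / 2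
  have hη : 0 < η := by positivity
  obtain ⟨t, ht, hcov⟩ := Metric.totallyBounded_iff.1 hb η hη
  have hF : ∀ x : A, ∃ z : t, dist (P x) z < η := fun x => by
    have := hcov ⟨x, x.2, rfl⟩
    simp only [Set.mem_iUnion, exists_prop] at this
    obtain ⟨z, hz, hxz⟩ := this
    exact ⟨⟨z, hz⟩, hxz⟩
  choose F hF using hF
  refine ⟨t, ht.fintype, F, fun x y hxy => ?_⟩
  have hd : dist (P x) (P y) ≤ √(ε ^ 2 / (4 * (s.card + 1))) := by
    have h1 := hF x
    have h2 := hF y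
    rw [← hxy] at h2
    have h3 := dist_triangle_right (P x) (P y) (F x)
    simp only [η] at h1 h2
    linarith
  have hterm : ∀ m ∈ s, L m (x - y : E) ^ 2 ≤ ε ^ 2 / (4 * (s.card + 1)) := fun m hm => by
    have h1 : |L m (x - y : E)| ≤ √(ε ^ 2 / (4 * (s.card + 1))) := by
      refine le_trans ?_ hd
      have := dist_le_pi_dist (P x) (P y) ⟨m, hm⟩
      simpa [P, Real.dist_eq, map_sub] using this
    rw [← Real.sqrt_sq_eq_abs] at h1
    exact (Real.sqrt_le_sqrt_iff (by positivity)).1 h1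
  have hsum : ∑ m ∈ s, L m (x - y : E) ^ 2 ≤ ε ^ 2 / 4 := by
    refine (Finset.sum_le_card_nsmul _ _ _ hterm).trans ?_
    rw [nsmul_eq_mul, ← mul_div_assoc, div_le_div_iff₀ (by positivity) (by norm_num)]
    have : 0 ≤ ε ^ 2 := sq_nonneg ε
    nlinarith
  have hle := hL x x.2 y y.2
  change dist (x : E) (y : E) < ε
  rw [dist_eq_norm]
  refine lt_of_pow_lt_pow_left₀ 2 hε.le ?_
  have : 0 < ε ^ 2 := by positivity
  linarith

theorem isCompact_closure_sublevel (H : Admissible q S c)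
    (hest : ∀ ε > 0, ∃ (s : Finset (Fin n → ℤ)) (L : (Fin n → ℤ) → L2 q →L[ℝ] ℝ),
      ∀ φ ∈ formDomain q S,
        inner ℝ φ φ ≤ ∑ m ∈ s, L m φ ^ 2 + ε * (form q S φ φ + inner ℝ φ φ))
    {θ : ℝ} (hθ : 0 < θ) : IsCompact (closure (sublevel q S θ)) := by
  have hnorm : ∀ φ ∈ sublevel q S θ, form q S φ φ ≤ 1 ∧ ‖φ‖ ^ 2 ≤ 1 / θ := fun φ hφ => by
    have h1 := hφ.2
    have h2 := form_self_nonneg H φ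
    rw [real_inner_self_eq_norm_sq] at h1
    have h3 : 0 ≤ θ * ‖φ‖ ^ 2 := by positivity
    refine ⟨by linarith, ?_⟩
    rw [le_div_iff₀ hθ]
    linarith
  refine TotallyBounded.isCompact_of_isClosed (TotallyBounded.closure ?_) isClosed_closure
  refine totallyBounded_of_forall_le_sum_sq (ι := Fin n → ℤ) ?_ fun ε hε => ?_
  · refine (Metric.isBounded_closedBall (x := (0 : L2 q)) (r := √(1 / θ))).subset fun φ hφ => ?_
    rw [mem_closedBall_zero_iff]
    exact Real.le_sqrt_of_sq_le (hnorm φ hφ).2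
  -- For `x`, `y` in the sublevel set, the form of `x - y` is at most `4` and its squared norm at
  -- most `4 / θ`.
  · obtain ⟨s, L, hL⟩ := hest (ε / (4 + 4 / θ)) (by positivity)
    refine ⟨s, L, fun x hx y hy => ?_⟩
    have h1 := hL (x - y) ((formSubmodule H).sub_mem hx.1 hy.1)
    have h2 := form_self_sub_le H hx.1 hy.1
    have h3 := parallelogram_law_with_norm ℝ x y
    rw [real_inner_self_eq_norm_sq] at h1
    obtain ⟨hx1, hx2⟩ := hnorm x hx
    obtain ⟨hy1, hy2⟩ := hnorm y hy
    have h4 : form q S (x - y) (x - y) + ‖x - y‖ ^ 2 ≤ 4 + 4 / θ := by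
      have : 4 / θ = 4 * (1 / θ) := by ring
      nlinarith [sq_nonneg ‖x + y‖]
    refine h1.trans ?_
    gcongr
    calc ε / (4 + 4 / θ) * (form q S (x - y) (x - y) + ‖x - y‖ ^ 2)
        ≤ ε / (4 + 4 / θ) * (4 + 4 / θ) := by gcongr
      _ = ε := by field_simp

/-! ### The kernel of the form -/

/-- Apply Poincaré on the ball to approximating test functions. Their energies tend to zero because
`φ` has none, so only the square of the mean survives. -/
theorem ball_estimate (H : Admissible q S c) (hcore : IsCore q S (CK2 q)) (R : ℝ) {φ : L2 q}
    (hφ : φ ∈ formDomain q S) (h0 : form q S φ φ = 0) :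
    (population q).real (Metric.closedBall 0 R) *
        ∫ x in Metric.closedBall 0 R, φ x ^ 2 ∂population q ≤
      (∫ x in Metric.closedBall 0 R, φ x ∂population q) ^ 2 := by
  have := H.prob
  set K := Metric.closedBall (0 : State n) R
  have hK : MeasurableSet K := Metric.isClosed_closedBall.measurableSet
  obtain ⟨m, hm0, hm⟩ := H.exists_lower_bound (isCompact_closedBall (0 : State n) R)
  obtain ⟨M, hM⟩ := H.exists_upper_bound (isCompact_closedBall (0 : State n) R)
  obtain ⟨u, hu, hlim, hform⟩ := hcore.exists_seq H hφ
  obtain ⟨L, hL⟩ := exists_clm_setIntegral H hK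
  set P := LpToLpRestrictCLM (State n) ℝ ℝ (population q) 2 K
  have hP : ∀ ψ : L2 q, ∫ x in K, ψ x ^ 2 ∂population q = ‖P ψ‖ ^ 2 := fun ψ => by
    rw [← real_inner_self_eq_norm_sq, L2.inner_def]
    refine integral_congr_ae ?_
    filter_upwards [LpToLpRestrictCLM_coeFn ℝ K ψ] with x hx
    rw [hx]
    simp [pow_two]
  set B : ℝ := 2 ^ n * (R + R) ^ 2 * (M / m) ^ 2 * (population q).real K * (2 / c)
  have hB : 0 ≤ B := by have := H.ell_pos; positivity
  have hb : ∀ k, (population q).real K * ‖P (u k)‖ ^ 2 ≤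
      L (u k) ^ 2 + B * (2 * form q S (u k - φ) (u k - φ)) := fun k => by
    obtain ⟨w, hw, hc, hw'⟩ := hu k
    have hw1 : ContDiff ℝ 1 w := hw.of_le (by norm_num)
    have hp := H.poincare (convex_closedBall 0 R) hK hm0 (d := R + R) (fun x hx y hy => by
      rw [mem_closedBall_zero_iff] at hx hy
      exact (norm_sub_le y x).trans (add_le_add hy hx)) hm hM hw1 hc
    have h1 := setIntegral_norm_fderiv_sq_le (S := S) H hw1 hc hw' K
    have h2 := form_self_le H hφ (hcore.1 (hu k))
    rw [h0, mul_zero, add_zero] at h2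
    rw [← hP, hL, setIntegral_congr_population hw' K (fun y => y ^ 2),
      setIntegral_congr_population hw' K (fun y => y)]
    refine hp.trans (add_le_add le_rfl ?_)
    calc 2 ^ n * (R + R) ^ 2 * (M / m) ^ 2 * (population q).real K *
          ∫ x in K, ‖fderiv ℝ w x‖ ^ 2 ∂population q
        ≤ 2 ^ n * (R + R) ^ 2 * (M / m) ^ 2 * (population q).real K *
          (2 / c * form q S (u k) (u k)) := by gcongr
      _ = B * form q S (u k) (u k) := by simp only [B]; ring
      _ ≤ _ := by gcongr
  have t1 := ((((P.continuous.tendsto φ).comp hlim).norm.pow 2).const_mul ((population q).real K))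
  have t2 := (((L.continuous.tendsto φ).comp hlim).pow 2).add ((hform.const_mul 2).const_mul B)
  have h := le_of_tendsto_of_tendsto' t1 t2 hb
  rw [hP, ← hL]
  simpa using h

/-- Let the radius tend to infinity. This reverses Cauchy-Schwarz against `1`; it does not require
constants to belong to the form domain. -/
theorem inner_self_le_of_form_eq_zero (H : Admissible q S c) (hcore : IsCore q S (CK2 q))
    {φ : L2 q} (hφ : φ ∈ formDomain q S) (h0 : form q S φ φ = 0) :
    inner ℝ φ φ ≤ (∫ x, φ x ∂population q) ^ 2 := by
  have := H.prob
  have hu : ⋃ R : ℕ, Metric.closedBall (0 : State n) R = Set.univ := Metric.iUnion_closedBall_nat 0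
  have hmono : Monotone fun R : ℕ => Metric.closedBall (0 : State n) R := fun a b hab =>
    Metric.closedBall_subset_closedBall (by exact_mod_cast hab)
  have hlim : ∀ f : State n → ℝ, Integrable f (population q) →
      Tendsto (fun R : ℕ => ∫ x in Metric.closedBall 0 R, f x ∂population q) atTop
        (𝓝 (∫ x, f x ∂population q)) := fun f hf => by
    have := tendsto_setIntegral_of_monotone (μ := population q) (f := f)
      (s := fun R : ℕ => Metric.closedBall (0 : State n) R)
      (fun R => Metric.isClosed_closedBall.measurableSet) hmono hf.integrableOn
    rwa [hu, Measure.restrict_univ] at this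
  have t0 := hlim (fun _ => 1) (integrable_const _)
  simp only [integral_const, smul_eq_mul, mul_one, measureReal_restrict_apply_univ,
    probReal_univ] at t0
  have t1 := t0.mul (hlim _ (integrable_sq φ))
  have t2 := (hlim _ ((Lp.memLp φ).integrable (by norm_num))).pow 2
  have h := le_of_tendsto_of_tendsto' t1 t2 fun R => ball_estimate H hcore R hφ h0
  rw [inner_self_eq_integral]
  simpa using h

/-! ### Maximizers of the norm under a quadratic constraint -/

section Maximizer

variable {E : Type*} [NormedAddCommGroup E] [InnerProductSpace ℝ E]

/-- A nonnegative quadratic form `e` on the subspace `U`, closed with respect to the norm, whose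
sublevel sets are precompact. -/
structure CompactForm (U : Submodule ℝ E) (e : E → ℝ) : Prop where
  nonneg : ∀ φ ∈ U, 0 ≤ e φ
  smul : ∀ φ ∈ U, ∀ a : ℝ, e (a • φ) = a ^ 2 * e φ
  parallelogram : ∀ φ ∈ U, ∀ ψ ∈ U, e (φ + ψ) + e (φ - ψ) = 2 * e φ + 2 * e ψ
  closed : ∀ (u : ℕ → E) (φ : E), (∀ k, u k ∈ U) → Tendsto u atTop (𝓝 φ) →
    (∀ ε > 0, ∃ N, ∀ k ≥ N, ∀ l ≥ N, e (u k - u l) ≤ ε) →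
    φ ∈ U ∧ Tendsto (fun k => e (u k - φ)) atTop (𝓝 0)
  compact : IsCompact (closure {φ | φ ∈ U ∧ e φ + ‖φ‖ ^ 2 ≤ 1})

variable {U : Submodule ℝ E} {e : E → ℝ}

theorem CompactForm.exists_subseq (h : CompactForm U e) {u : ℕ → E} (hu : ∀ k, u k ∈ U) {B : ℝ}
    (hB : 0 < B) (hb : ∀ k, e (u k) + ‖u k‖ ^ 2 ≤ B) :
    ∃ φ, ∃ σ : ℕ → ℕ, StrictMono σ ∧ Tendsto (u ∘ σ) atTop (𝓝 φ) := by
  have hmem : ∀ k, (√B)⁻¹ • u k ∈ closure {φ | φ ∈ U ∧ e φ + ‖φ‖ ^ 2 ≤ 1} := fun k => by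
    refine subset_closure ⟨U.smul_mem _ (hu k), ?_⟩
    rw [h.smul _ (hu k), norm_smul, mul_pow, Real.norm_eq_abs, sq_abs, ← mul_add, inv_pow,
      Real.sq_sqrt hB.le, inv_mul_le_iff₀ hB, mul_one]
    exact hb k
  obtain ⟨φ, -, σ, hσ, hlim⟩ := h.compact.tendsto_subseq hmem
  refine ⟨√B • φ, σ, hσ, (hlim.const_smul (√B)).congr fun k => ?_⟩
  simp [smul_smul, (Real.sqrt_pos.2 hB).ne']

/-- The difference `b = e - a‖·‖²` is nonnegative and obeys the parallelogram law, so `b (ψ - χ) ≤ 2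
* b ψ + 2 * b χ`. If `b (u k) → 0` and `u` converges in norm, then `u` is Cauchy for `e`, and
closedness applies. It is used with `a = 0` for the kernel and `a = s⁻¹` for the maximizer. -/
theorem CompactForm.eq_of_tendsto (h : CompactForm U e) {a : ℝ}
    (ha : ∀ ψ ∈ U, a * ‖ψ‖ ^ 2 ≤ e ψ) {u : ℕ → E} {φ : E} (hu : ∀ k, u k ∈ U)
    (hlim : Tendsto u atTop (𝓝 φ))
    (hb : Tendsto (fun k => e (u k) - a * ‖u k‖ ^ 2) atTop (𝓝 0)) :
    φ ∈ U ∧ e φ = a * ‖φ‖ ^ 2 := by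
  set b : E → ℝ := fun ψ => e ψ - a * ‖ψ‖ ^ 2
  have hb0 : ∀ ψ ∈ U, 0 ≤ b ψ := fun ψ hψ => sub_nonneg.2 (ha ψ hψ)
  have hbsub : ∀ ψ ∈ U, ∀ χ ∈ U, b (ψ - χ) ≤ 2 * b ψ + 2 * b χ := fun ψ hψ χ hχ => by
    have h1 := h.parallelogram ψ hψ χ hχ
    have h2 := parallelogram_law_with_norm ℝ ψ χ
    have h3 := hb0 _ (U.add_mem hψ hχ)
    have h4 : a * (‖ψ + χ‖ ^ 2 + ‖ψ - χ‖ ^ 2) = a * (2 * (‖ψ‖ ^ 2 + ‖χ‖ ^ 2)) := by rw [h2]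
    simp only [b] at h3 ⊢
    linarith
  have hC : ∀ ε > 0, ∃ N, ∀ k ≥ N, ∀ l ≥ N, e (u k - u l) ≤ ε := by
    intro ε hε
    -- The two `b` terms contribute at most `ε / 2`; the norm tolerance chosen next keeps `|a| * ‖u
    -- k - u l‖ ^ 2` below the other half.
    have h1 := (Metric.tendsto_atTop.1 hb) (ε / 8) (by positivity)
    obtain ⟨N₁, hN₁⟩ := h1
    obtain ⟨N₂, hN₂⟩ := Metric.cauchySeq_iff.1 hlim.cauchySeq (√(ε / (2 * (|a| + 1))))
      (by positivity)
    refine ⟨max N₁ N₂, fun k hk l hl => ?_⟩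
    have e1 := hN₁ k (le_of_max_le_left hk)
    have e2 := hN₁ l (le_of_max_le_left hl)
    rw [Real.dist_0_eq_abs] at e1 e2
    have e3 := hN₂ k (le_of_max_le_right hk) l (le_of_max_le_right hl)
    rw [dist_eq_norm] at e3
    have e4 : ‖u k - u l‖ ^ 2 ≤ ε / (2 * (|a| + 1)) := by
      rw [← Real.sq_sqrt (show 0 ≤ ε / (2 * (|a| + 1)) by positivity)]
      gcongr
    rw [le_div_iff₀ (by positivity)] at e4
    have e5 := hbsub _ (hu k) _ (hu l)
    have e6 : a * ‖u k - u l‖ ^ 2 ≤ |a| * ‖u k - u l‖ ^ 2 := by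
      gcongr
      exact le_abs_self a
    have e7 := (abs_lt.1 e1).2
    have e8 := (abs_lt.1 e2).2
    have e9 := sq_nonneg ‖u k - u l‖
    simp only [b] at e5 e7 e8
    nlinarith
  obtain ⟨hφ, hφlim⟩ := h.closed u φ hu hlim hC
  refine ⟨hφ, le_antisymm ?_ (ha φ hφ)⟩
  have hn : Tendsto (fun k => ‖u k - φ‖ ^ 2) atTop (𝓝 0) := by
    simpa using (tendsto_iff_norm_sub_tendsto_zero.1 hlim).pow 2
  have hle : ∀ k, b φ ≤ 2 * b (u k) + 2 * (e (u k - φ) - a * ‖u k - φ‖ ^ 2) := fun k => by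
    have := hbsub _ (hu k) _ (U.sub_mem (hu k) hφ)
    rwa [sub_sub_cancel] at this
  have hz := ge_of_tendsto' ((hb.const_mul 2).add ((hφlim.sub (hn.const_mul a)).const_mul 2)) hle
  simp only [b, mul_zero, sub_zero, add_zero] at hz
  linarith

/-- Otherwise normalization gives unit vectors whose energy tends to zero; a subsequence converges
to a unit vector of zero energy, against `hker`. -/
theorem CompactForm.exists_bound (h : CompactForm U e) (hker : ∀ φ ∈ U, e φ = 0 → φ = 0) :
    ∃ B, ∀ φ ∈ U, e φ = 1 → ‖φ‖ ^ 2 ≤ B := by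
  by_contra! hcon
  choose u hu he hn using fun k : ℕ => hcon (k + 1)
  have hu0 : ∀ k, 0 < ‖u k‖ := fun k => by
    have h1 := hn k
    by_contra! h2
    have h3 : ‖u k‖ = 0 := le_antisymm h2 (norm_nonneg _)
    rw [h3] at h1
    have : (0 : ℝ) ≤ k := Nat.cast_nonneg k
    norm_num at h1
    linarith
  set v : ℕ → E := fun k => ‖u k‖⁻¹ • u k
  have hv : ∀ k, v k ∈ U := fun k => U.smul_mem _ (hu k)
  have hvn : ∀ k, ‖v k‖ = 1 := fun k => by
    simp [v, norm_smul, (hu0 k).ne']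
  have hve : ∀ k, e (v k) ≤ 1 / ((k : ℝ) + 1) := fun k => by
    simp only [v]
    rw [h.smul _ (hu k), he, mul_one, inv_pow, ← one_div]
    exact one_div_le_one_div_of_le (by positivity) (hn k).le
  obtain ⟨φ, σ, hσ, hlim⟩ := h.exists_subseq hv (B := 2) two_pos fun k => by
    have h1 := hve k
    have h2 : 1 / ((k : ℝ) + 1) ≤ 1 := by
      rw [div_le_one (by positivity)]
      have : (0 : ℝ) ≤ k := Nat.cast_nonneg k
      linarith
    rw [hvn]
    linarith
  have he0 : Tendsto (fun k => e (v k)) atTop (𝓝 0) :=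
    squeeze_zero (fun k => h.nonneg _ (hv k)) hve tendsto_one_div_add_atTop_nhds_zero_nat
  obtain ⟨hφ, hφe⟩ := h.eq_of_tendsto (a := 0) (fun ψ hψ => by simpa using h.nonneg ψ hψ)
    (fun k => hv (σ k)) hlim (by
      simpa [Function.comp_def] using he0.comp hσ.tendsto_atTop)
  have hφ0 := hker φ hφ (by simpa using hφe)
  have hn1 : Tendsto (fun k => ‖(v ∘ σ) k‖) atTop (𝓝 ‖φ‖) := hlim.norm
  simp only [Function.comp, hvn, hφ0, norm_zero] at hn1
  exact one_ne_zero (tendsto_nhds_unique tendsto_const_nhds hn1)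

theorem CompactForm.exists_maximizer (h : CompactForm U e) (hker : ∀ φ ∈ U, e φ = 0 → φ = 0)
    (hne : ∃ φ ∈ U, φ ≠ 0) :
    ∃ φ ∈ U, e φ = 1 ∧ ∀ ψ ∈ U, e ψ = 1 → ‖ψ‖ ^ 2 ≤ ‖φ‖ ^ 2 := by
  obtain ⟨B, hB⟩ := h.exists_bound hker
  have hscale : ∀ ψ ∈ U, ψ ≠ 0 → 0 < e ψ ∧ e ((√(e ψ))⁻¹ • ψ) = 1 ∧
      ‖(√(e ψ))⁻¹ • ψ‖ ^ 2 = ‖ψ‖ ^ 2 / e ψ := fun ψ hψ hψ0 => by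
    have hpos : 0 < e ψ := (h.nonneg ψ hψ).lt_of_ne fun h0 => hψ0 (hker ψ hψ h0.symm)
    refine ⟨hpos, ?_, ?_⟩
    · rw [h.smul ψ hψ, inv_pow, Real.sq_sqrt hpos.le, inv_mul_cancel₀ hpos.ne']
    · rw [norm_smul, mul_pow, Real.norm_eq_abs, sq_abs, inv_pow, Real.sq_sqrt hpos.le,
        inv_mul_eq_div]
  set A : Set ℝ := {r | ∃ ψ ∈ U, e ψ = 1 ∧ ‖ψ‖ ^ 2 = r}
  have hAb : BddAbove A := ⟨B, by rintro r ⟨ψ, hψ, hψe, rfl⟩; exact hB ψ hψ hψe⟩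
  obtain ⟨χ, hχ, hχ0⟩ := hne
  obtain ⟨hχpos, hχ1, hχn⟩ := hscale χ hχ hχ0
  have hχA : ‖χ‖ ^ 2 / e χ ∈ A := ⟨_, U.smul_mem _ hχ, hχ1, hχn⟩
  set s := sSup A
  have hs : 0 < s := lt_of_lt_of_le (by have := norm_pos_iff.2 hχ0; positivity) (le_csSup hAb hχA)
  -- Homogeneity extends the bound by the supremum from `e ψ = 1` to all of `U`, as `eq_of_tendsto`
  -- requires.
  have hle : ∀ ψ ∈ U, s⁻¹ * ‖ψ‖ ^ 2 ≤ e ψ := fun ψ hψ => by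
    rcases eq_or_ne ψ 0 with rfl | hψ0
    · simpa using h.nonneg 0 hψ
    · obtain ⟨hpos, h1, h2⟩ := hscale ψ hψ hψ0
      have h3 : ‖ψ‖ ^ 2 / e ψ ≤ s := le_csSup hAb ⟨_, U.smul_mem _ hψ, h1, h2⟩
      rw [div_le_iff₀ hpos] at h3
      rwa [inv_mul_le_iff₀ hs]
  obtain ⟨r, -, hr, hrA⟩ := exists_seq_tendsto_sSup ⟨_, hχA⟩ hAb
  choose u hu hue hur using hrA
  obtain ⟨φ, σ, hσ, hlim⟩ := h.exists_subseq hu (B := 1 + s) (by positivity) fun k => by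
    have : ‖u k‖ ^ 2 ≤ s := le_csSup hAb ⟨_, hu k, hue k, rfl⟩
    rw [hue]
    linarith
  have hns : Tendsto (fun k => ‖u (σ k)‖ ^ 2) atTop (𝓝 s) := by
    simp only [hur]
    exact hr.comp hσ.tendsto_atTop
  obtain ⟨hφ, hφe⟩ := h.eq_of_tendsto hle (fun k => hu (σ k)) hlim (by
    have := (hns.const_mul s⁻¹).const_sub 1
    rw [inv_mul_cancel₀ hs.ne', sub_self] at this
    simpa only [Function.comp, hue] using this)
  have hφn : ‖φ‖ ^ 2 = s := tendsto_nhds_unique (hlim.norm.pow 2) hns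
  refine ⟨φ, hφ, by rw [hφe, hφn, inv_mul_cancel₀ hs.ne'], fun ψ hψ hψe => ?_⟩
  rw [hφn]
  exact le_csSup hAb ⟨ψ, hψ, hψe, rfl⟩

end Maximizer

/-! ### Recursive choice of a sequence -/

/-- The sequence whose `j`-th term is computed by `F` from the terms of index less than `j`. -/
noncomputable def strongSeq {α : Type*} (d : α) (F : ℕ → (ℕ → α) → α) (j : ℕ) : α :=
  F j fun s => if _h : s < j then strongSeq d F s else d
termination_by j

/-- `hP` says that `P j` sees only the terms before `j`, so the default values used from `j` on by
`strongSeq` are irrelevant. -/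
theorem exists_seq_of_forall_exists {α : Type*} [Nonempty α] (P : ℕ → (ℕ → α) → α → Prop)
    (hP : ∀ j f g a, (∀ s < j, f s = g s) → P j f a → P j g a)
    (hex : ∀ j f, (∀ s < j, P s f (f s)) → ∃ a, P j f a) : ∃ f : ℕ → α, ∀ j, P j f (f j) := by
  classical
  obtain ⟨d⟩ := ‹Nonempty α›
  -- The choice is made total here; that a valid term exists is proved later, by induction along the
  -- sequence.
  have hF : ∀ j f, ∃ a, (∃ b, P j f b) → P j f a := fun j f => by
    by_cases h : ∃ b, P j f b
    · exact ⟨h.choose, fun _ => h.choose_spec⟩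
    · exact ⟨d, fun h' => absurd h' h⟩
  choose F hF using hF
  refine ⟨strongSeq d F, fun j => ?_⟩
  induction j using Nat.strong_induction_on with
  | _ j ih =>
    set g : ℕ → α := fun s => if _h : s < j then strongSeq d F s else d
    have hg : ∀ s < j, strongSeq d F s = g s := fun s hs => by simp [g, hs]
    have hj : strongSeq d F j = F j g := by rw [strongSeq]
    obtain ⟨a, ha⟩ := hex j (strongSeq d F) ih
    rw [hj]
    exact hP j g _ _ (fun s hs => (hg s hs).symm) (hF j g ⟨a, hP j _ g a hg ha⟩)

/-! ### The constrained form domain -/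

/-- The elements of the form domain that are orthogonal to `ψ s` for all `s < j`. -/
def constrainedSubmodule (H : Admissible q S c) (ψ : ℕ → L2 q) (j : ℕ) : Submodule ℝ (L2 q) where
  carrier := {φ | φ ∈ formDomain q S ∧ ∀ s < j, inner ℝ (ψ s) φ = 0}
  zero_mem' := ⟨(formSubmodule H).zero_mem, fun s _ => inner_zero_right _⟩
  add_mem' := fun h h' => ⟨(formSubmodule H).add_mem h.1 h'.1, fun s hs => by
    rw [inner_add_right, h.2 s hs, h'.2 s hs, add_zero]⟩
  smul_mem' := fun a _ h => ⟨(formSubmodule H).smul_mem a h.1, fun s hs => by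
    rw [inner_smul_right, h.2 s hs, mul_zero]⟩

theorem compactForm_constrained (H : Admissible q S c)
    (hcpt : IsCompact (closure (sublevel q S 1))) (ψ : ℕ → L2 q) (j : ℕ) :
    CompactForm (constrainedSubmodule H ψ j) fun φ => form q S φ φ where
  nonneg φ _ := form_self_nonneg H φ
  smul φ hφ a := form_self_smul H hφ.1 a
  parallelogram φ hφ χ hχ := form_self_parallelogram H hφ.1 hχ.1
  closed u φ hu hlim hC := by
    obtain ⟨h1, h2⟩ := form_closed H (fun k => (hu k).1) hlim hC
    refine ⟨⟨h1, fun s hs => ?_⟩, h2⟩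
    have h3 : Tendsto (fun k => inner ℝ (ψ s) (u k)) atTop (𝓝 (inner ℝ (ψ s) φ)) :=
      tendsto_const_nhds.inner hlim
    simp only [(hu _).2 s hs] at h3
    exact tendsto_nhds_unique h3 tendsto_const_nhds
  compact := by
    refine hcpt.of_isClosed_subset isClosed_closure (closure_mono fun φ hφ => ⟨hφ.1.1, ?_⟩)
    rw [real_inner_self_eq_norm_sq, one_mul]
    exact hφ.2

/-- Take bumps of outer radius `1/4` at integer points of the first axis. Each vanishes at the other
centres, so evaluating there isolates the coefficients; continuity upgrades the a.e. relation to a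
pointwise one. -/
theorem exists_test_functions (H : Admissible q S c) (hn : 0 < n) (N : ℕ) :
    ∃ β : Fin N → L2 q, (∀ k, β k ∈ CK2 q) ∧
      ∀ a : Fin N → ℝ, ∑ k, a k • β k = 0 → a = 0 := by
  have := H.prob
  set p : Fin N → State n := fun k => EuclideanSpace.single ⟨0, hn⟩ (k : ℝ)
  set f : (k : Fin N) → ContDiffBump (p k) := fun k => ⟨1 / 8, 1 / 4, by norm_num, by norm_num⟩
  have hmem : ∀ k, MemLp (f k) 2 (population q) := fun k =>
    (f k).continuous.memLp_of_hasCompactSupport (f k).hasCompactSupport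
  refine ⟨fun k => (hmem k).toLp, fun k => ⟨f k, (f k).contDiff, (f k).hasCompactSupport,
    (hmem k).coeFn_toLp⟩, fun a ha => ?_⟩
  have hae : (fun x => ∑ k, a k * f k x) =ᵐ[volume] fun _ => (0 : ℝ) := by
    refine H.volume_ac.ae_le ?_
    have h1 : ∀ᵐ x ∂population q, ∀ k, (a k • (hmem k).toLp) x = a k * f k x := by
      rw [ae_all_iff]
      intro k
      filter_upwards [Lp.coeFn_smul (a k) (hmem k).toLp, (hmem k).coeFn_toLp] with x hx hx'
      rw [hx, Pi.smul_apply, hx', smul_eq_mul]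
    filter_upwards [h1, Lp.coeFn_finsetSum Finset.univ fun k => a k • (hmem k).toLp,
      Lp.coeFn_zero ℝ 2 (population q)] with x hx hx' hx0
    rw [ha, hx0] at hx'
    simp only [Finset.sum_apply, hx] at hx'
    exact hx'.symm
  have hz : (fun x => ∑ k, a k * f k x) = fun _ => (0 : ℝ) := by
    refine (Continuous.ae_eq_iff_eq volume ?_ continuous_const).1 hae
    exact continuous_finsetSum _ fun k _ => continuous_const.mul (f k).continuous
  funext l
  have hl := congrFun hz (p l)
  rw [Finset.sum_eq_single l] at hl
  · rwa [(f l).one_of_mem_closedBall (by simp [f]), mul_one] at hl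
  · intro k _ hkl
    have hd : (f k) (p l) = 0 := by
      refine (f k).zero_of_le_dist ?_
      have h1 : dist (p l) (p k) = |(l : ℝ) - k| := by
        simp only [p, EuclideanSpace.single, PiLp.dist_single_same, Real.dist_eq]
      have h2 : (1 : ℝ) ≤ |(l : ℝ) - k| := by
        have : (1 : ℤ) ≤ |((l : ℕ) : ℤ) - (k : ℕ)| :=
          Int.one_le_abs (by
            have := Fin.val_ne_of_ne hkl
            omega)
        exact_mod_cast this
      rw [h1]
      change (1 / 4 : ℝ) ≤ _
      linarith
    rw [hd, mul_zero]
  · simp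

/-- Dimension count: `j + 1` independent test functions against `j` linear conditions. -/
theorem exists_ne_zero_constrained (H : Admissible q S c) (hn : 0 < n)
    (hC : CK2 q ⊆ formDomain q S) (ψ : ℕ → L2 q) (j : ℕ) :
    ∃ φ ∈ constrainedSubmodule H ψ j, φ ≠ 0 := by
  obtain ⟨β, hβ, hind⟩ := exists_test_functions H hn (j + 1)
  set T : (Fin (j + 1) → ℝ) →ₗ[ℝ] (Fin j → ℝ) :=
    LinearMap.pi fun s : Fin j => (innerSL ℝ (ψ s)).toLinearMap ∘ₗ Fintype.linearCombination ℝ β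
  have hT : LinearMap.ker T ≠ ⊥ := LinearMap.ker_ne_bot_of_finrank_lt (by simp)
  obtain ⟨a, haT, ha⟩ := Submodule.exists_mem_ne_zero_of_ne_bot hT
  refine ⟨∑ k, a k • β k, ⟨(formSubmodule H).sum_mem fun k _ =>
    (formSubmodule H).smul_mem _ (hC (hβ k)), fun s hs => ?_⟩, fun h0 => ha (hind a h0)⟩
  have := congrFun (LinearMap.mem_ker.1 haT) ⟨s, hs⟩
  simpa [T, Fintype.linearCombination_apply] using this

theorem eq_zero_of_form_eq_zero (H : Admissible q S c) (hcore : IsCore q S (CK2 q)) {φ ψ : L2 q}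
    (hφ : φ ∈ formDomain q S) (h0 : form q S φ φ = 0)
    (hψ : ψ =ᵐ[population q] fun _ => (1 : ℝ)) (horth : inner ℝ ψ φ = 0) : φ = 0 := by
  have h1 : ∫ x, φ x ∂population q = 0 := by
    rw [← horth, L2.inner_def]
    refine integral_congr_ae ?_
    filter_upwards [hψ] with x hx
    rw [hx]
    simp
  have h2 := inner_self_le_of_form_eq_zero H hcore hφ h0
  rw [h1] at h2
  refine inner_self_eq_zero.1 (le_antisymm (by simpa using h2) real_inner_self_nonneg)

/-! ### Extraction of the components -/

theorem constraintSet_congr {ψ ψ' : ℕ → L2 q} {j : ℕ} (h : ∀ s < j, ψ s = ψ' s) :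
    constraintSet q S ψ j = constraintSet q S ψ' j := by
  ext φ
  refine and_congr Iff.rfl (and_congr Iff.rfl (forall₂_congr fun s hs => ?_))
  rw [h s hs]

theorem exists_isNPCSequence (H : Admissible q S c) (hn : 0 < n) (hcore : IsCore q S (CK2 q))
    (hcpt : IsCompact (closure (sublevel q S 1))) : ∃ ψ : ℕ → L2 q, IsNPCSequence q S ψ := by
  have := H.prob
  set P : ℕ → (ℕ → L2 q) → L2 q → Prop := fun j ψ φ =>
    (j = 0 → φ =ᵐ[population q] fun _ => (1 : ℝ)) ∧
      (1 ≤ j → φ ∈ constraintSet q S ψ j ∧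
        ∀ χ ∈ constraintSet q S ψ j, inner ℝ χ χ ≤ inner ℝ φ φ)
  obtain ⟨ψ, hψ⟩ := exists_seq_of_forall_exists P
    (fun j f g a hfg h => by
      refine ⟨h.1, fun hj => ?_⟩
      rw [← constraintSet_congr hfg]
      exact h.2 hj)
    (fun j f hf => by
      rcases Nat.eq_zero_or_pos j with rfl | hj
      · exact ⟨(memLp_const (1 : ℝ)).toLp, fun _ => MemLp.coeFn_toLp _, fun h => absurd h (by simp)⟩
      · obtain ⟨φ, hφ, hφ1, hmax⟩ := (compactForm_constrained H hcpt f j).exists_maximizer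
          -- For `j ≥ 1` the constraint at index `0` is orthogonality to the constant `1`, which
          -- removes the kernel of the form.
          (fun φ hφ h0 =>
            eq_zero_of_form_eq_zero H hcore hφ.1 h0 ((hf 0 hj).1 rfl) (hφ.2 0 hj))
          (exists_ne_zero_constrained H hn hcore.1 f j)
        refine ⟨φ, fun h => absurd h hj.ne', fun _ => ⟨⟨hφ.1, hφ1, hφ.2⟩, fun χ hχ => ?_⟩⟩
        rw [real_inner_self_eq_norm_sq, real_inner_self_eq_norm_sq]
        exact hmax χ ⟨hχ.1, hχ.2.2⟩ hχ.2.1)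
  exact ⟨ψ, (hψ 0).1 rfl, fun j hj => (hψ j).2 hj⟩

theorem admissible_of_regular (hq_pos : ∀ x, 0 < q x) (hq_diff : ContDiff ℝ 1 q)
    (hq_prob : IsProbabilityMeasure (population q))
    (hS_diff : ∀ i j, ContDiff ℝ 1 fun x => S x i j) (hc : 0 < c)
    (hS_lower : ∀ x, (S x - c • (1 : Matrix (Fin n) (Fin n) ℝ)).PosSemidef) :
    Admissible q S c where
  pos := hq_pos
  cont := hq_diff.continuous
  prob := hq_prob
  coeff_cont i j := (hS_diff i j).continuous
  ell_pos := hc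
  ell x a := by
    have h := (hS_lower x).dotProduct_mulVec_nonneg a
    simp only [star_trivial, Matrix.sub_mulVec, Matrix.smul_mulVec, Matrix.one_mulVec,
      dotProduct_sub, dotProduct_smul, smul_eq_mul] at h
    linarith

end NPC

theorem mainTheorem1 {n : ℕ} (hn : 0 < n)
    (q : NPC.State n → ℝ) (S : NPC.State n → Matrix (Fin n) (Fin n) ℝ)
    -- `q` is a positive, continuously differentiable probability density
    (hq_pos : ∀ x, 0 < q x) (hq_diff : ContDiff ℝ 1 q)
    (hq_prob : IsProbabilityMeasure (NPC.population q))
    -- `Σ` is a continuously differentiable, (symmetric) positive definite matrix function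
    (hS_diff : ∀ i j, ContDiff ℝ 1 (fun x => S x i j)) (hS_pos : ∀ x, (S x).PosDef)
    -- `C_K^2` is a core of the form
    (h_core : NPC.IsCore q S (NPC.CK2 q))
    -- `h` is twice continuously differentiable
    (hh : ContDiff ℝ 2 (NPC.logDensity q))
    -- `Σ ≥ c I` for some `c > 0`
    (hS_lower : ∃ c : ℝ, 0 < c ∧
      ∀ x, (S x - c • (1 : Matrix (Fin n) (Fin n) ℝ)).PosSemidef)
    -- the potential diverges
    (hV : Tendsto (NPC.potential q S) (cocompact (NPC.State n)) atTop) :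
    (∀ θ : ℝ, 0 < θ → IsCompact (closure (NPC.sublevel q S θ))) ∧
      ∃ ψ : ℕ → NPC.L2 q, NPC.IsNPCSequence q S ψ := by
  obtain ⟨c, hc, hSc⟩ := hS_lower
  have H := NPC.admissible_of_regular hq_pos hq_diff hq_prob hS_diff hc hSc
  -- Only the symmetry in `hS_pos` is needed; quantitative positivity comes from the bound by `c`.
  have hsymm : ∀ x i j, S x i j = S x j i := fun x i j => by
    simpa using (hS_pos x).isHermitian.apply j i
  have hcpt : ∀ θ : ℝ, 0 < θ → IsCompact (closure (NPC.sublevel q S θ)) := fun θ hθ =>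
    NPC.isCompact_closure_sublevel H
      (fun ε hε => NPC.domain_estimate H hsymm hq_diff hS_diff hh hV h_core hε) hθ
  exact ⟨hcpt, NPC.exists_isNPCSequence H hn h_core (hcpt 1 one_pos)⟩
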